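/- **Model.** Running time is measured on a (deterministic) random access machine with logarithmic cost: memory consists of finitely many arrays of natural numbers, and every arithmetic operation, memory access and test costs the bit length of the numbers involved. Up to polylogarithmic factors this is the time on a word RAM with words of $O(\log n)$ bits. **3-OV hypothesis.** Vectors $u,v,w\in\{0,1\}^d$ are orthogonal if for every coordinate $j$ at least one of $u_j,v_j,w_j$ is $0$. The 3-OV problem asks, given three families $A,B,C$ of $n$ vectors in $\{0,1\}^d$ each, whether there are $u\in A$, $v\in B$, $w\in C$ that are orthogonal. The 3-OV hypothesis says that 3-OV in dimension $d=\Theta(\log n)$ requires $n^{3-o(1)}$ time, that is: for every $\varepsilon>0$ there is a constant $c$ such that no algorithm solves 3-OV in dimension $d=c\lceil\log_2 n\rceil$ in time $O(n^{3-\varepsilon})$. **Transformers.** An attention head with embedding dimension $m$ maps $X\in\mathbb{R}^{N\times m}$ to $\mathrm{softmax}(Q(X)K(X)^{\top})V(X)\in\mathbb{R}^{N\times m}$, where $Q,K,V:\mathbb{R}^m\to\mathbb{R}^m$ and the softmax are applied row-wise. A transformer with $L$ layers and $H$ heads per layer and summation aggregation computes $X^{(0)}=X$, $X^{(\ell)}=\Psi_\ell\bigl(X^{(\ell-1)}+\sum_{h=1}^{H}f_{\ell,h}(X^{(\ell-1)})\bigr)$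 for $1\le\ell\le L$, and outputs $\Psi_O(X^{(L)})$, where the $f_{\ell,h}$ are attention heads and the MLPs $\Psi_\ell,\Psi_O$ are continuous maps applied row-wise. It has no MLPs if all $\Psi_\ell$ and $\Psi_O$ are the identity. **Theorem.** Assume the 3-OV hypothesis. Let $m=\Theta(\log N)$ and $L,H=\mathrm{poly}(N)$. Then any algorithm that computes transformers with input length $N$, embedding dimension $m$, $L$ layers, $H$ heads in each layer, and input and output dimension $m$ up to entry-wise additive error $\frac{1}{10N}$ requires $LHN^{2-o(1)}$ time, even if the transformers have no MLPs. Precisely: for every $\varepsilon>0$ and every $k\in\mathbb{N}$ there is a constant $c$ such that the following holds. Let $m,L,H:\mathbb{N}\to\mathbb{N}$ be functions with $m(N)=\Theta(\log N)$, $m(N)\ge c\log_2N$ and $L(N),H(N)\ge1$ for all large $N$, and $L(N),H(N)=O(N^k)$, and suppose that $m(N),L(N),H(N)$ can be computed from $N$ in time $O(N^k)$. Let $b\ge1$ be an integer. Then there is no algorithm that, for all sufficiently large $N$, given any transformer without MLPs with these parameters, whose embeddings $Q,K,V$ are linear maps $x\mapsto xW$ given by weight matrices $W\in\mathbb{Q}^{m(N)\times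 m(N)}$, and any input $X\in\mathbb{Q}^{N\times m(N)}$, where the numerators and denominators of all entries are at most $N^b$ in absolute value, outputs rational approximations of all entries of the transformer's output with additive error at most $\frac{1}{10N}$, in time $O(L(N)H(N)N^{2-\varepsilon})$. -/

import Mathlib

open Filter Asymptotics

/-! ## Random access machines with logarithmic cost

A program works on finitely many arrays (named by numerals in the program text), each an infinite
sequence of cells that hold natural numbers; addresses are computed, so access is random.  Every
arithmetic operation, memory access and test is charged the bit length of the numbers involved.
Up to polylogarithmic factors this is the running time on a word RAM with logarithmic word size. -/

namespace RAM

/-- The contents of the memory: `s a i` is the content of cell `i` of array `a`. -/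
abbrev State : Type := ℕ → ℕ → ℕ

/-- Subtraction is truncated at `0`, division is rounded down, and division by `0` gives `0`. -/
inductive Op : Type
  | add | sub | mul | div

def Op.eval : Op → ℕ → ℕ → ℕ
  | .add, x, y => x + y
  | .sub, x, y => x - y
  | .mul, x, y => x * y
  | .div, x, y => x / y

/-- Expressions; `load a e` reads the cell of array `a` whose address is the value of `e`. -/
inductive Expr : Type
  | lit (n : ℕ)
  | load (a : ℕ) (e : Expr)
  | bin (o : Op) (e₁ e₂ : Expr)

def Expr.eval (s : State) : Expr → ℕ
  | .lit n => n
  | .load a e => s a (e.eval s)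
  | .bin o e₁ e₂ => o.eval (e₁.eval s) (e₂.eval s)

/-- Logarithmic cost of an evaluation: every node is charged one plus the bit length of its value
(so operands, addresses and results are all paid for). -/
def Expr.cost (s : State) : Expr → ℕ
  | .lit n => 1 + n.size
  | .load a e => e.cost s + (1 + (s a (e.eval s)).size)
  | .bin o e₁ e₂ =>
      e₁.cost s + e₂.cost s + (1 + (o.eval (e₁.eval s) (e₂.eval s)).size)

/-- Programs; `store a i e` writes the value of `e` to cell `i` of array `a`, and a test succeeds
when the value of its expression is not `0`. -/
inductive Prog : Type
  | skip
  | store (a : ℕ) (i e : Expr)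
  | seq (p q : Prog)
  | ite (e : Expr) (p q : Prog)
  | loop (e : Expr) (p : Prog)

/-- The memory after writing `v` to cell `i` of array `a`. -/
def State.write (s : State) (a i v : ℕ) : State :=
  fun a' i' => if a' = a ∧ i' = i then v else s a' i'

/-- `Exec p s s' t`: started in `s`, the program `p` halts in `s'` after time `t`. -/
inductive Exec : Prog → State → State → ℕ → Prop
  | skip (s : State) : Exec .skip s s 1
  | store (s : State) (a : ℕ) (i e : Expr) :
      Exec (.store a i e) s (s.write a (i.eval s) (e.eval s)) (i.cost s + e.cost s + 1)
  | seq {p q : Prog} {s s₁ s₂ : State} {t₁ t₂ : ℕ} :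
      Exec p s s₁ t₁ → Exec q s₁ s₂ t₂ → Exec (.seq p q) s s₂ (t₁ + t₂)
  | iteTrue {e : Expr} {p q : Prog} {s s₁ : State} {t : ℕ} :
      e.eval s ≠ 0 → Exec p s s₁ t → Exec (.ite e p q) s s₁ (e.cost s + 1 + t)
  | iteFalse {e : Expr} {p q : Prog} {s s₁ : State} {t : ℕ} :
      e.eval s = 0 → Exec q s s₁ t → Exec (.ite e p q) s s₁ (e.cost s + 1 + t)
  | loopTrue {e : Expr} {p : Prog} {s s₁ s₂ : State} {t₁ t₂ : ℕ} :
      e.eval s ≠ 0 → Exec p s s₁ t₁ → Exec (.loop e p) s₁ s₂ t₂ →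
        Exec (.loop e p) s s₂ (e.cost s + 1 + t₁ + t₂)
  | loopFalse {e : Expr} {p : Prog} {s : State} :
      e.eval s = 0 → Exec (.loop e p) s s (e.cost s + 1)

/-- Programs are deterministic, in result and running time. -/
theorem Exec.deterministic {p : Prog} {s s₁ s₂ : State} {t₁ t₂ : ℕ}
    (h₁ : Exec p s s₁ t₁) (h₂ : Exec p s s₂ t₂) : s₁ = s₂ ∧ t₁ = t₂ := by
  induction h₁ generalizing s₂ t₂ with
  | skip s => cases h₂; exact ⟨rfl, rfl⟩
  | store s a i e => cases h₂; exact ⟨rfl, rfl⟩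
  | seq _ _ ih₁ ih₂ =>
    cases h₂ with
    | seq h h' =>
      obtain ⟨rfl, rfl⟩ := ih₁ h
      obtain ⟨rfl, rfl⟩ := ih₂ h'
      exact ⟨rfl, rfl⟩
  | iteTrue he _ ih =>
    cases h₂ with
    | iteTrue _ h => obtain ⟨rfl, rfl⟩ := ih h; exact ⟨rfl, rfl⟩
    | iteFalse he' _ => exact absurd he' he
  | iteFalse he _ ih =>
    cases h₂ with
    | iteTrue he' _ => exact absurd he he'
    | iteFalse _ h => obtain ⟨rfl, rfl⟩ := ih h; exact ⟨rfl, rfl⟩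
  | loopTrue he _ _ ih₁ ih₂ =>
    cases h₂ with
    | loopTrue _ h h' =>
      obtain ⟨rfl, rfl⟩ := ih₁ h
      obtain ⟨rfl, rfl⟩ := ih₂ h'
      exact ⟨rfl, rfl⟩
    | loopFalse he' => exact absurd he' he
  | loopFalse he =>
    cases h₂ with
    | loopTrue he' _ _ => exact absurd he he'
    | loopFalse _ => exact ⟨rfl, rfl⟩

/-- Started in `s`, the program halts within time `T`, in a state that satisfies `post`. -/
def RunsWithin (p : Prog) (s : State) (T : ℝ) (post : State → Prop) : Prop :=
  ∃ (s' : State) (t : ℕ), Exec p s s' t ∧ (t : ℝ) ≤ T ∧ post s'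

/-- Results are delivered in this array. -/
def outArray : ℕ := 5

/-! ### Input formats -/

/-- The array that holds the numbers `v 0, …, v (n - 1)`, followed by zeros. -/
def natArray {n : ℕ} (v : Fin n → ℕ) : ℕ → ℕ :=
  fun p => if h : p < n then v ⟨p, h⟩ else 0

/-- A rational number `x` occupies three cells, that hold `a`, `b`, `c` with `x = (a - b) / c`:
the positive and the negative part of the numerator, and the denominator. -/
def ratCode (x : ℚ) : Fin 3 → ℕ :=
  ![x.num.toNat, (-x.num).toNat, x.den]

/-- The array that holds the codes of `v 0, …, v (n - 1)`, followed by zeros. -/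
def ratArray {n : ℕ} (v : Fin n → ℚ) : ℕ → ℕ :=
  fun p => if h : p / 3 < n then ratCode (v ⟨p / 3, h⟩) ⟨p % 3, Nat.mod_lt p (by norm_num)⟩ else 0

/-- Row-major order: the entry `f i j` is at position `i * b + j`. -/
def rowMajor {α : Type} {a b : ℕ} (f : Fin a → Fin b → α) : Fin (a * b) → α :=
  fun p => f p.divNat p.modNat

end RAM

open RAM

/-! ## The 3-OV hypothesis -/

/-- Three `0`-`1` vectors are orthogonal: in every coordinate, one of them is `0`. -/
def OrthogonalTriple {d : ℕ} (u v w : Fin d → Bool) : Prop :=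
  ∀ j, u j = false ∨ v j = false ∨ w j = false

/-- The input of a 3-OV instance: `n` and `d` in array `0`, the three families of vectors in the
arrays `1`, `2`, `3`. -/
def ovInput {n d : ℕ} (A B C : Fin n → Fin d → Bool) : State
  | 0 => natArray ![n, d]
  | 1 => natArray (rowMajor fun i j => (A i j).toNat)
  | 2 => natArray (rowMajor fun i j => (B i j).toNat)
  | 3 => natArray (rowMajor fun i j => (C i j).toNat)
  | _ => fun _ => 0

/-- The program `P` decides 3-OV on three families of `n` vectors of dimension `d n` in time
`O(T n)`. -/
def SolvesThreeOV (P : Prog) (d : ℕ → ℕ) (T : ℕ → ℝ) : Prop :=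
  ∃ K : ℝ, ∀ᶠ n : ℕ in atTop, ∀ A B C : Fin n → Fin (d n) → Bool,
    RunsWithin P (ovInput A B C) (K * T n) fun s =>
      (s outArray 0 ≠ 0 ↔ ∃ i j k, OrthogonalTriple (A i) (B j) (C k))

/-- The 3-OV hypothesis: deciding 3-OV on `n` vectors of dimension `Θ(log n)` requires time
`n ^ (3 - o(1))`.  That is, for every `ε > 0` there is a constant `c` such that no algorithm runs in
time `O(n ^ (3 - ε))` in dimension `c * ⌈log₂ n⌉`. -/
def ThreeOVHypothesis : Prop :=
  ∀ ε : ℝ, 0 < ε → ∃ c : ℕ,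
    ¬ ∃ P : Prog, SolvesThreeOV P (fun n => c * Nat.clog 2 n) (fun n => (n : ℝ) ^ (3 - ε))

/-! ## Transformers -/

noncomputable section

/-- The softmax of a vector. -/
def softmax {N : ℕ} (v : Fin N → ℝ) : Fin N → ℝ :=
  fun i => Real.exp (v i) / ∑ j, Real.exp (v j)

/-- A self-attention head with embedding dimension `m`, given by its query, key and value
embeddings, which act on single tokens. -/
structure AttentionHead (m : ℕ) where
  Q : (Fin m → ℝ) → Fin m → ℝ
  K : (Fin m → ℝ) → Fin m → ℝ
  V : (Fin m → ℝ) → Fin m → ℝ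

/-- `softmax (Q(X) K(X)ᵀ) V(X)`, where `Q`, `K`, `V` and softmax are applied row by row. -/
def AttentionHead.apply {m N : ℕ} (f : AttentionHead m) (X : Matrix (Fin N) (Fin m) ℝ) :
    Matrix (Fin N) (Fin m) ℝ :=
  let q : Matrix (Fin N) (Fin m) ℝ := Matrix.of fun i => f.Q (X i)
  let k : Matrix (Fin N) (Fin m) ℝ := Matrix.of fun i => f.K (X i)
  let v : Matrix (Fin N) (Fin m) ℝ := Matrix.of fun i => f.V (X i)
  (Matrix.of fun i => softmax ((q * k.transpose) i)) * v

/-- A transformer with embedding and input dimension `m`, `L` layers, `H` heads in each layer,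
output dimension `dout`, and summation aggregation; an MLP is a continuous map, which is applied to
every row. -/
structure Transformer (m L H dout : ℕ) where
  head : Fin L → Fin H → AttentionHead m
  mlp : Fin L → C(Fin m → ℝ, Fin m → ℝ)
  outMlp : C(Fin m → ℝ, Fin dout → ℝ)

namespace Transformer

variable {m L H dout N : ℕ}

/-- `X ↦ Ψ_ℓ (X + ∑ h, f_{ℓ, h} (X))`. -/
def layer (T : Transformer m L H dout) (ℓ : Fin L) (X : Matrix (Fin N) (Fin m) ℝ) :
    Matrix (Fin N) (Fin m) ℝ :=
  Matrix.of fun i => T.mlp ℓ ((X + ∑ h, (T.head ℓ h).apply X) i)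

/-- The output on input `X`: the layers `0, …, L - 1` are applied in this order, and then the output
MLP. -/
def eval (T : Transformer m L H dout) (X : Matrix (Fin N) (Fin m) ℝ) :
    Matrix (Fin N) (Fin dout) ℝ :=
  Matrix.of fun i => T.outMlp (Fin.foldl L (fun Y ℓ => T.layer ℓ Y) X i)

end Transformer

/-- Rational weight matrices for the query, key and value embeddings of all heads. -/
structure Weights (m L H : ℕ) where
  Q : Fin L → Fin H → Matrix (Fin m) (Fin m) ℚ
  K : Fin L → Fin H → Matrix (Fin m) (Fin m) ℚ
  V : Fin L → Fin H → Matrix (Fin m) (Fin m) ℚ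

/-- The transformer without MLPs (all of them are the identity) whose embeddings are the linear maps
`x ↦ x W` for the given weight matrices `W`. -/
def Weights.transformer {m L H : ℕ} (W : Weights m L H) : Transformer m L H m where
  head ℓ h :=
    { Q := fun x => Matrix.vecMul x ((W.Q ℓ h).map (fun r : ℚ => (r : ℝ)))
      K := fun x => Matrix.vecMul x ((W.K ℓ h).map (fun r : ℚ => (r : ℝ)))
      V := fun x => Matrix.vecMul x ((W.V ℓ h).map (fun r : ℚ => (r : ℝ))) }
  mlp _ := ContinuousMap.id _
  outMlp := ContinuousMap.id _

end

/-! ## Algorithms that compute transformers -/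

/-- The numerator and the denominator of `x` are at most `B` in absolute value. -/
def RatBounded (B : ℕ) (x : ℚ) : Prop :=
  x.num.natAbs ≤ B ∧ x.den ≤ B

def Weights.Bounded {m L H : ℕ} (B : ℕ) (W : Weights m L H) : Prop :=
  ∀ ℓ h i j, RatBounded B (W.Q ℓ h i j) ∧ RatBounded B (W.K ℓ h i j) ∧ RatBounded B (W.V ℓ h i j)

/-- All weight matrices, one after the other, each in row-major order. -/
def flattenWeights {m L H : ℕ} (W : Fin L → Fin H → Matrix (Fin m) (Fin m) ℚ) :
    Fin (L * (H * (m * m))) → ℚ :=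
  rowMajor fun ℓ => rowMajor fun h => rowMajor fun i j => W ℓ h i j

/-- The input of an algorithm that computes transformers: the parameters in array `0`, the tokens in
array `1`, the weights in the arrays `2`, `3`, `4`. -/
def transformerInput {N m L H : ℕ} (W : Weights m L H) (X : Matrix (Fin N) (Fin m) ℚ) : State
  | 0 => natArray ![N, m, L, H]
  | 1 => ratArray (rowMajor fun i j => X i j)
  | 2 => ratArray (flattenWeights W.Q)
  | 3 => ratArray (flattenWeights W.K)
  | 4 => ratArray (flattenWeights W.V)
  | _ => fun _ => 0

/-- The output array holds, for each entry of `Y` in row-major order, three numbers `a`, `b`, `c`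
with `c ≠ 0` such that `(a - b) / c` is the entry up to an additive error of at most `δ`. -/
def OutputsApprox {N m : ℕ} (Y : Matrix (Fin N) (Fin m) ℝ) (δ : ℝ) (s : State) : Prop :=
  ∀ (i : Fin N) (j : Fin m),
    let p := 3 * ((i : ℕ) * m + j)
    s outArray (p + 2) ≠ 0 ∧
      |((s outArray p : ℝ) - (s outArray (p + 1) : ℝ)) / (s outArray (p + 2) : ℝ) - Y i j| ≤ δ

/-- In time `O(T N)`, the program `P` computes, up to entry-wise additive error `1 / (10 N)`, all
transformers without MLPs with input length `N`, embedding, input and output dimension `m N`, with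
`L N` layers and `H N` heads in each layer, whose embeddings are given by weight matrices; the
numerators and denominators of weights and inputs are at most `N ^ b`, so they have `O(log N)`
bits. -/
def ComputesTransformers (P : Prog) (m L H : ℕ → ℕ) (b : ℕ) (T : ℕ → ℝ) : Prop :=
  ∃ K : ℝ, ∀ᶠ N : ℕ in atTop,
    ∀ (W : Weights (m N) (L N) (H N)) (X : Matrix (Fin N) (Fin (m N)) ℚ),
      W.Bounded (N ^ b) → (∀ i j, RatBounded (N ^ b) (X i j)) →
        RunsWithin P (transformerInput W X) (K * T N)
          (OutputsApprox (W.transformer.eval (X.map (fun r : ℚ => (r : ℝ)))) (1 / (10 * (N : ℝ))))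

/-- The parameters `m N`, `L N`, `H N` can be computed from `N` in time `O(T N)`. -/
def ComputableParams (m L H : ℕ → ℕ) (T : ℕ → ℝ) : Prop :=
  ∃ (P : Prog) (K : ℝ), ∀ᶠ N : ℕ in atTop,
    RunsWithin P (fun a => if a = 0 then natArray ![N] else fun _ => 0) (K * T N) fun s =>
      s outArray 0 = m N ∧ s outArray 1 = L N ∧ s outArray 2 = H N

/-! The proof is a fine-grained reduction from 3-OV. An attention head computes all pairwise scores
between tokens, so a fixed third vector, stored in its query matrix, lets it search all pairs `(v,
w)` for a partner. Token `j` carries `v j` and the complement of `w j`. The query matrix masks `v j`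
with `u` and multiplies by `N`; the key matrix moves the complement of `w k` into the same
coordinates. The score of `(j, k)` is then `N` times the number of coordinates where `u` and `v j`
are `1` and `w k` is `0`. Token `0` plays the zero vector in the third family, so it always attains
the maximal score. Another token `k` ties with it exactly when `u, v j, w k` are orthogonal, and
otherwise loses a factor of at least `exp N` in softmax weight. The value matrix copies the flag
"not token `0`" into an otherwise empty coordinate. A head thus contributes at least `1/2` if `j`
has a partner (`half_le_attentionShare`) and at most `N * exp (-N)` if not (`attentionShare_le`). No
head reads the coordinate that is written, so the residual connections simply add up all `L * H`
heads (`orthogonality_eval`). The sums are at least `1/2` or at most `1/10`, and an error of `1/(10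
N)` cannot blur that.

Given `n` vectors per family, take `N` as the `e`-th root of `n` with `e = 2k + 2`, so that `L * H ≤
n`. Cut the first family into chunks of `L * H` and the other two into blocks of `N - 1`, one token
being reserved. One transformer per choice of chunk and blocks covers every triple
(`exists_found_iff`). There are `O(n^3 / (L H N^2))` transformers (`M_mul_le`), so time `L H
N^(2-ε)` for each gives `n^3 N^(-ε)` up to logarithms. As `N` is polynomially related to `n`, this
beats `n^(3-ε')` for some `ε' > 0` (`solvesThreeOV`).

On the machine, the given algorithm must start from clean memory every time, and erasing what it
wrote would need bookkeeping. Instead the `M` runs are interleaved: run `i` uses only addresses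
congruent to `i` modulo `M` (`Exec.relocate`), which costs a factor `O(log M)`. The numbers that the
algorithm outputs have no a priori size bound; their total length is charged to its running time
(`Exec.sum_size_le`). -/

namespace RAM

/-! ## Expressions -/

instance : Add Expr := ⟨.bin .add⟩
instance : Sub Expr := ⟨.bin .sub⟩
instance : Mul Expr := ⟨.bin .mul⟩
instance : Div Expr := ⟨.bin .div⟩
instance (n : ℕ) : OfNat Expr n := ⟨.lit n⟩

namespace Expr

variable (s : State) (x y : Expr)

@[simp] theorem eval_add : (x + y).eval s = x.eval s + y.eval s := rfl
@[simp] theorem eval_sub : (x - y).eval s = x.eval s - y.eval s := rfl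
@[simp] theorem eval_mul : (x * y).eval s = x.eval s * y.eval s := rfl
@[simp] theorem eval_div : (x / y).eval s = x.eval s / y.eval s := rfl
@[simp] theorem eval_ofNat (n : ℕ) :
    (no_index (OfNat.ofNat n : Expr)).eval s = OfNat.ofNat n := rfl
@[simp] theorem eval_load (a : ℕ) : (load a x).eval s = s a (x.eval s) := rfl

theorem cost_add : (x + y).cost s = x.cost s + y.cost s + (1 + (x.eval s + y.eval s).size) := rfl
theorem cost_sub : (x - y).cost s = x.cost s + y.cost s + (1 + (x.eval s - y.eval s).size) := rfl
theorem cost_mul : (x * y).cost s = x.cost s + y.cost s + (1 + (x.eval s * y.eval s).size) := rfl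
theorem cost_load (a : ℕ) : (load a x).cost s = x.cost s + (1 + (s a (x.eval s)).size) := rfl
theorem cost_ofNat (n : ℕ) :
    (no_index (OfNat.ofNat n : Expr)).cost s = 1 + (OfNat.ofNat n : ℕ).size := rfl

/-- The remainder. -/
def mod : Expr := x - x / y * y

@[simp] theorem eval_mod : (mod x y).eval s = x.eval s % y.eval s := by
  simp only [mod, eval_sub, eval_mul, eval_div]
  rw [mul_comm, ← Nat.mod_eq_sub_mul_div]

/-- The indicator of `x < y`. -/
def lt : Expr := 1 - (x + 1 - y)

@[simp] theorem eval_lt : (lt x y).eval s = if x.eval s < y.eval s then 1 else 0 := by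
  simp only [lt, eval_sub, eval_add, eval_ofNat]
  split_ifs <;> omega

/-- The indicator of `x = y`. -/
def eq : Expr := 1 - ((x - y) + (y - x))

@[simp] theorem eval_eq : (eq x y).eval s = if x.eval s = y.eval s then 1 else 0 := by
  simp only [eq, eval_sub, eval_add, eval_ofNat]
  split_ifs <;> omega

/-- The power with a fixed exponent. -/
def pow : ℕ → Expr
  | 0 => 1
  | e + 1 => pow e * x

@[simp] theorem eval_pow (e : ℕ) : (x.pow e).eval s = x.eval s ^ e := by
  induction e with
  | zero => simp [pow]
  | succ e ih => simp [pow, ih, _root_.pow_succ]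

/-- All arrays that are read by an expression satisfy `S`. -/
def Reads (S : ℕ → Prop) : Expr → Prop
  | lit _ => True
  | load a e => S a ∧ e.Reads S
  | bin _ e₁ e₂ => e₁.Reads S ∧ e₂.Reads S

variable {x y} {S : ℕ → Prop}

@[simp] theorem reads_add : (x + y).Reads S ↔ x.Reads S ∧ y.Reads S := Iff.rfl
@[simp] theorem reads_sub : (x - y).Reads S ↔ x.Reads S ∧ y.Reads S := Iff.rfl
@[simp] theorem reads_mul : (x * y).Reads S ↔ x.Reads S ∧ y.Reads S := Iff.rfl
@[simp] theorem reads_div : (x / y).Reads S ↔ x.Reads S ∧ y.Reads S := Iff.rfl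
@[simp] theorem reads_ofNat (n : ℕ) : (no_index (OfNat.ofNat n : Expr)).Reads S := trivial
@[simp] theorem reads_load (a : ℕ) : (load a x).Reads S ↔ S a ∧ x.Reads S := Iff.rfl
@[simp] theorem reads_mod : (mod x y).Reads S ↔ x.Reads S ∧ y.Reads S := by
  simp [mod]
@[simp] theorem reads_lt : (lt x y).Reads S ↔ x.Reads S ∧ y.Reads S := by
  simp [lt]
@[simp] theorem reads_eq : (eq x y).Reads S ↔ x.Reads S ∧ y.Reads S := by
  simp [eq]; tauto
theorem Reads.pow (h : x.Reads S) (e : ℕ) : (x.pow e).Reads S := by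
  induction e with
  | zero => trivial
  | succ e ih => exact ⟨ih, h⟩

/-- Allows the length of an intermediate value to be charged to the cost of computing it. -/
theorem size_eval_lt_cost (x : Expr) : (x.eval s).size < x.cost s := by
  cases x with
  | lit n => simp [eval, cost]
  | load a e => simp only [eval, cost]; omega
  | bin o x y => simp only [eval, cost]; omega

end Expr

/-! ### Bit lengths and uniform cost bounds -/

theorem size_add_le (x y : ℕ) : (x + y).size ≤ max x.size y.size + 1 := by
  rw [Nat.size_le, pow_succ]
  have hx : x < 2 ^ max x.size y.size :=
    (Nat.lt_size_self x).trans_le (Nat.pow_le_pow_right two_pos (le_max_left _ _))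
  have hy : y < 2 ^ max x.size y.size :=
    (Nat.lt_size_self y).trans_le (Nat.pow_le_pow_right two_pos (le_max_right _ _))
  omega

theorem size_mul_le (x y : ℕ) : (x * y).size ≤ x.size + y.size := by
  rw [Nat.size_le, pow_add]
  exact Nat.mul_lt_mul'' (Nat.lt_size_self x) (Nat.lt_size_self y)

theorem Op.size_eval_le (o : Op) (x y : ℕ) : (o.eval x y).size ≤ x.size + y.size + 1 := by
  cases o with
  | add => have := size_add_le x y; simp only [Op.eval]; omega
  | sub => have := Nat.size_le_size (Nat.sub_le x y); simp only [Op.eval]; omega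
  | mul => have := size_mul_le x y; simp only [Op.eval]; omega
  | div => have := Nat.size_le_size (Nat.div_le_self x y); simp only [Op.eval]; omega

/-- An upper bound for the cost of an expression, in multiples of the bit length of the numbers that
it reads. -/
def Expr.weight : Expr → ℕ
  | lit n => 1 + n.size
  | load _ e => e.weight + 2
  | bin _ e₁ e₂ => 2 * (e₁.weight + e₂.weight) + 2

/-- The result of an operation is at most one bit longer than its operands together, and each
operand is shorter than its own cost; hence the doubling in `weight`. All fixed expressions of the
reduction thereby cost a constant times `β`, and the constants never need to be evaluated. -/
theorem Expr.cost_le {S : ℕ → Prop} {s : State} {β : ℕ} (hβ : 1 ≤ β)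
    (hs : ∀ a, S a → ∀ x, (s a x).size ≤ β) {e : Expr} (he : e.Reads S) :
    e.cost s ≤ e.weight * β := by
  induction e with
  | lit n => exact Nat.le_mul_of_pos_right _ hβ
  | load a e ih =>
    have h₁ := ih he.2
    have h₂ := hs a he.1 (e.eval s)
    simp only [cost, weight, add_mul]
    omega
  | bin o x y ihx ihy =>
    have h₁ := ihx he.1
    have h₂ := ihy he.2
    have h₃ := o.size_eval_le (x.eval s) (y.eval s)
    have h₄ := x.size_eval_lt_cost s
    have h₅ := y.size_eval_lt_cost s
    simp only [cost, weight, add_mul, mul_add, mul_assoc]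
    omega

/-! ## Programs -/

/-- Started in `s`, the program `p` halts within time `T`, in a state that satisfies `post`. -/
def Runs (p : Prog) (s : State) (T : ℕ) (post : State → Prop) : Prop :=
  ∃ (s' : State) (t : ℕ), Exec p s s' t ∧ t ≤ T ∧ post s'

namespace Runs

variable {p q : Prog} {s : State} {T T₁ T₂ : ℕ} {post post' : State → Prop} {e : Expr}

theorem mono (h : Runs p s T₁ post) (hT : T₁ ≤ T₂) (hp : ∀ s', post s' → post' s') :
    Runs p s T₂ post' := by
  obtain ⟨s', t, h₁, h₂, h₃⟩ := h
  exact ⟨s', t, h₁, h₂.trans hT, hp _ h₃⟩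

theorem mono_time (h : Runs p s T₁ post) (hT : T₁ ≤ T₂) : Runs p s T₂ post :=
  h.mono hT fun _ => id

theorem skip (h : post s) : Runs .skip s 1 post := ⟨s, 1, .skip s, le_rfl, h⟩

theorem store {a : ℕ} {i e : Expr} (h : post (s.write a (i.eval s) (e.eval s))) :
    Runs (.store a i e) s (i.cost s + e.cost s + 1) post :=
  ⟨_, _, .store s a i e, le_rfl, h⟩

theorem seq (h : Runs p s T₁ post) (h' : ∀ s', post s' → Runs q s' T₂ post') :
    Runs (.seq p q) s (T₁ + T₂) post' := by
  obtain ⟨s₁, t₁, h₁, h₂, h₃⟩ := h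
  obtain ⟨s₂, t₂, h₄, h₅, h₆⟩ := h' _ h₃
  exact ⟨s₂, _, h₁.seq h₄, Nat.add_le_add h₂ h₅, h₆⟩

theorem ite (h₁ : e.eval s ≠ 0 → Runs p s T post) (h₂ : e.eval s = 0 → Runs q s T post) :
    Runs (.ite e p q) s (e.cost s + 1 + T) post := by
  by_cases he : e.eval s = 0
  · obtain ⟨s', t, h, ht, hp⟩ := h₂ he
    exact ⟨s', _, .iteFalse he h, by omega, hp⟩
  · obtain ⟨s', t, h, ht, hp⟩ := h₁ he
    exact ⟨s', _, .iteTrue he h, by omega, hp⟩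

/-- A loop with the invariant `I`, that is run for the values `a, …, b - 1` of a counter. -/
theorem loop (I : ℕ → State → Prop) (κ : ℕ) (c : ℕ → ℕ) {a b : ℕ} (hab : a ≤ b)
    (hstep : ∀ j s, a ≤ j → j < b → I j s →
      e.eval s ≠ 0 ∧ e.cost s + 1 ≤ κ ∧ Runs p s (c j) (I (j + 1)))
    (hend : ∀ s, I b s → e.eval s = 0 ∧ e.cost s + 1 ≤ κ) (hs : I a s) :
    Runs (.loop e p) s (∑ j ∈ Finset.Ico a b, (κ + c j) + κ) (I b) := by
  induction h : b - a generalizing a s with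
  | zero =>
    obtain rfl : a = b := by omega
    obtain ⟨h₁, h₂⟩ := hend s hs
    exact ⟨s, _, .loopFalse h₁, by simpa using h₂, hs⟩
  | succ r ih =>
    have hlt : a < b := by omega
    obtain ⟨h₁, h₂, s₁, t₁, h₃, h₄, h₅⟩ := hstep a s le_rfl hlt hs
    obtain ⟨s₂, t₂, h₆, h₇, h₈⟩ :=
      ih (a := a + 1) hlt (fun j s hj => hstep j s (by omega)) h₅ (by omega)
    refine ⟨s₂, _, .loopTrue h₁ h₃ h₆, ?_, h₈⟩
    rw [Finset.sum_eq_sum_Ico_succ_bot hlt]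
    omega

end Runs

/-- The total bit length of any cells of an array grows at most by the running time. -/
theorem Exec.sum_size_le {p : Prog} {s s' : State} {t : ℕ} (h : Exec p s s' t) (a : ℕ)
    (F : Finset ℕ) {φ : ℕ → ℕ} (hφ : φ.Injective) :
    ∑ j ∈ F, (s' a (φ j)).size ≤ ∑ j ∈ F, (s a (φ j)).size + t := by
  induction h with
  | skip => omega
  | store s b i e =>
    have h₁ := e.size_eval_lt_cost s
    have h₂ : ∀ j ∈ F, (s.write b (i.eval s) (e.eval s) a (φ j)).size ≤
        (s a (φ j)).size + if φ j = i.eval s then (e.eval s).size else 0 := by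
      intro j _
      simp only [State.write]
      split_ifs <;> omega
    refine (Finset.sum_le_sum h₂).trans ?_
    rw [Finset.sum_add_distrib]
    -- By injectivity of `φ`, at most one summand sees the written cell, so one store is paid for
    -- once.
    have h₃ : ∑ j ∈ F, (if φ j = i.eval s then (e.eval s).size else 0) ≤ (e.eval s).size := by
      rw [← Finset.sum_filter, Finset.sum_const, smul_eq_mul]
      refine (Nat.mul_le_mul_right _ (Finset.card_le_one.2 ?_)).trans (one_mul _).le
      intro x hx y hy
      simp only [Finset.mem_filter] at hx hy
      exact hφ (hx.2.trans hy.2.symm)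
    omega
  | seq _ _ ih₁ ih₂ => omega
  | iteTrue _ _ ih => omega
  | iteFalse _ _ ih => omega
  | loopTrue _ _ _ ih₁ ih₂ => omega
  | loopFalse => omega

/-! ## Simulation in a part of the memory

Array `a` of the simulated memory is kept in array `f a`; its cell `x` is the cell `x * M + i` there,
where `M` and `i` are the contents of the cells `0` and `1` of array `6`.  Different values of `i`
give disjoint parts of the memory. -/

/-- The address in the memory of the simulator. -/
def Expr.addr (x : Expr) : Expr := x * .load 6 0 + .load 6 1

@[simp] theorem Expr.eval_addr (s : State) (x : Expr) :
    x.addr.eval s = x.eval s * s 6 0 + s 6 1 := rfl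

@[simp] theorem Expr.reads_addr {S : ℕ → Prop} {x : Expr} :
    x.addr.Reads S ↔ x.Reads S ∧ S 6 := by
  simp [Expr.addr]

def Expr.relocate (f : ℕ → ℕ) : Expr → Expr
  | .lit n => .lit n
  | .load a e => .load (f a) (e.relocate f).addr
  | .bin o e₁ e₂ => .bin o (e₁.relocate f) (e₂.relocate f)

def Prog.relocate (f : ℕ → ℕ) : Prog → Prog
  | .skip => .skip
  | .store a i e => .store (f a) (i.relocate f).addr (e.relocate f)
  | .seq p q => .seq (p.relocate f) (q.relocate f)
  | .ite e p q => .ite (e.relocate f) (p.relocate f) (q.relocate f)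
  | .loop e p => .loop (e.relocate f) (p.relocate f)

/-- The part `i` of the memory `s` holds the simulated memory `v`. -/
structure Holds (f : ℕ → ℕ) (M i : ℕ) (s v : State) : Prop where
  stride : s 6 0 = M
  part : s 6 1 = i
  cell : ∀ a x, s (f a) (x * M + i) = v a x

/-- The memories `s` and `s'` agree outside of part `i`. -/
def AgreeOff (f : ℕ → ℕ) (M i : ℕ) (s s' : State) : Prop :=
  ∀ a x, ((∀ b, a ≠ f b) ∨ x % M ≠ i) → s' a x = s a x

section Simulation

variable {f : ℕ → ℕ} {M i : ℕ} {s v : State}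

theorem Expr.eval_relocate (h : Holds f M i s v) (e : Expr) :
    (e.relocate f).eval s = e.eval v := by
  induction e with
  | lit n => rfl
  | load a e ih => simp [relocate, ih, h.stride, h.part, h.cell, eval]
  | bin o x y ihx ihy => simp [relocate, ihx, ihy, eval]

theorem Expr.cost_addr_le (h : Holds f M i s v) (hi : i < M) {x : Expr} :
    x.addr.cost s ≤ x.cost s + 2 * (x.eval s).size + 4 * M.size + 8 := by
  have h₁ := size_mul_le (x.eval s) M
  have h₂ : (x.eval s * M + i).size ≤ (x.eval s).size + M.size + 1 := by
    have := size_add_le (x.eval s * M) i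
    have := Nat.size_le_size hi.le
    omega
  have h₃ := Nat.size_le_size hi.le
  simp only [addr, cost_add, cost_mul, cost_load, cost_ofNat, eval_mul, eval_load, eval_ofNat,
    h.stride, h.part, Nat.size_zero]
  have : Nat.size 1 = 1 := by simp
  omega

/-- The extra `2 * size` on the left strengthens the induction: it pays for multiplying an address
by the stride when the value is used in an enclosing `load` or in a store. -/
theorem Expr.cost_relocate_le (h : Holds f M i s v) (hi : i < M) (e : Expr) :
    (e.relocate f).cost s + 2 * (e.eval v).size ≤ (4 * M.size + 9) * e.cost v := by
  induction e with
  | lit n => simp only [relocate, cost, eval]; nlinarith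
  | load a e ih =>
    have h₁ := Expr.cost_addr_le h hi (x := e.relocate f)
    have h₂ : (4 * M.size + 9) * (load a e).cost v =
      (4 * M.size + 9) * e.cost v + (4 * M.size + 9) * (1 + (v a (e.eval v)).size) := by
      simp only [cost, mul_add]
    rw [h₂]
    simp only [relocate, cost_load, eval_addr, eval_relocate h, h.stride, h.part, h.cell,
      eval_load] at h₁ ⊢
    nlinarith
  | bin o x y ihx ihy =>
    simp only [relocate, cost, eval, eval_relocate h] at ihx ihy ⊢
    nlinarith

theorem Holds.write (hf : f.Injective) (hf6 : ∀ a, f a ≠ 6) (h : Holds f M i s v) (hi : i < M)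
    (a x y : ℕ) :
    Holds f M i (s.write (f a) (x * M + i) y) (v.write a x y) ∧
      AgreeOff f M i s (s.write (f a) (x * M + i) y) := by
  refine ⟨⟨?_, ?_, ?_⟩, ?_⟩
  · simp [State.write, (hf6 a).symm, h.stride]
  · simp [State.write, (hf6 a).symm, h.part]
  · intro b z
    have hM : M ≠ 0 := by omega
    simp [State.write, hf.eq_iff, hM, h.cell]
  · rintro b z hbz
    simp only [State.write]
    rw [if_neg]
    rintro ⟨rfl, rfl⟩
    rcases hbz with hb | hz
    · exact hb a rfl
    · apply hz
      -- Every address that part `i` uses is congruent to `i` modulo `M`.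
      rw [Nat.mul_add_mod', Nat.mod_eq_of_lt hi]

theorem AgreeOff.trans {s₁ s₂ s₃ : State} (h₁ : AgreeOff f M i s₁ s₂)
    (h₂ : AgreeOff f M i s₂ s₃) : AgreeOff f M i s₁ s₃ :=
  fun a x h => (h₂ a x h).trans (h₁ a x h)

/-- The simulation is slower by a factor of `O(log M)`. -/
theorem Exec.relocate (hf : f.Injective) (hf6 : ∀ a, f a ≠ 6) (hi : i < M) {p : Prog}
    {v v' : State} {t : ℕ} (hp : Exec p v v' t) (s : State) (h : Holds f M i s v) :
    Runs (p.relocate f) s ((4 * M.size + 9) * t)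
      fun s' => Holds f M i s' v' ∧ AgreeOff f M i s s' := by
  induction hp generalizing s with
  | skip v => exact ⟨s, _, .skip s, by omega, h, fun _ _ _ => rfl⟩
  | store v a j e =>
    have h₁ := Expr.cost_relocate_le h hi j
    have h₂ := Expr.cost_relocate_le h hi e
    have h₃ := Expr.cost_addr_le h hi (x := j.relocate f)
    rw [Expr.eval_relocate h] at h₃
    refine (Runs.store ?_).mono_time ?_
    · simpa [Expr.eval_relocate h, h.stride, h.part] using
        h.write hf hf6 hi a (j.eval v) (e.eval v)
    · nlinarith
  | seq _ _ ih₁ ih₂ =>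
    refine ((ih₁ s h).seq fun s₁ h₁ => (ih₂ s₁ h₁.1).mono le_rfl ?_).mono_time (by rw [mul_add])
    exact fun s₂ h₂ => ⟨h₂.1, h₁.2.trans h₂.2⟩
  | iteTrue he _ ih =>
    rename_i e p q v v₁ t _
    obtain ⟨s', t', h₁, h₂, h₃⟩ := ih s h
    have := Expr.cost_relocate_le h hi e
    exact ⟨s', _, .iteTrue (by rwa [Expr.eval_relocate h]) h₁, by nlinarith, h₃⟩
  | iteFalse he _ ih =>
    rename_i e p q v v₁ t _
    obtain ⟨s', t', h₁, h₂, h₃⟩ := ih s h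
    have := Expr.cost_relocate_le h hi e
    exact ⟨s', _, .iteFalse (by rwa [Expr.eval_relocate h]) h₁, by nlinarith, h₃⟩
  | loopTrue he _ _ ih₁ ih₂ =>
    rename_i e p v v₁ v₂ t₁ t₂ _ _
    obtain ⟨s₁, t₁', h₁, h₂, h₃⟩ := ih₁ s h
    obtain ⟨s₂, t₂', h₄, h₅, h₆⟩ := ih₂ s₁ h₃.1
    have := Expr.cost_relocate_le h hi e
    exact ⟨s₂, _, .loopTrue (by rwa [Expr.eval_relocate h]) h₁ h₄, by nlinarith,
      h₆.1, h₃.2.trans h₆.2⟩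
  | loopFalse he =>
    rename_i e p v
    have := Expr.cost_relocate_le h hi e
    exact ⟨s, _, .loopFalse (by rwa [Expr.eval_relocate h]), by nlinarith, h, fun _ _ _ => rfl⟩

end Simulation

end RAM

/-! ## A transformer that finds orthogonal triples

Token `j` holds the vectors `v j` and the complement of `w j`, and a flag that is `0` for token `0`
and `1` for the others; the vector `w 0` is replaced by the zero vector. -/

/-- Entry `c` of token `j`. -/
def tokenEntry (d : ℕ) (v w : ℕ → ℕ → ℕ) (j c : ℕ) : ℕ :=
  if c < d then v j c
  else if c < 2 * d then (if j = 0 then 1 else 1 - w j (c - d))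
  else if c = 2 * d ∧ j ≠ 0 then 1 else 0

/-- The entries of the query matrix for the vector `u`. -/
def queryEntry (N d : ℕ) (u : ℕ → ℕ) (a b : ℕ) : ℕ := if a = b ∧ a < d then N * u a else 0

/-- The entries of the key matrix. -/
def keyEntry (d a b : ℕ) : ℕ := if a = b + d ∧ b < d then 1 else 0

/-- The entries of the value matrix. -/
def valueEntry (d a b : ℕ) : ℕ := if a = 2 * d ∧ b = 2 * d + 1 then 1 else 0

/-- One head for each of the vectors `u 0, …, u (L * H - 1)`. -/
def orthogonalityWeights (N d m L H : ℕ) (u : ℕ → ℕ → ℕ) : Weights m L H where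
  Q ℓ h := Matrix.of fun a b => (queryEntry N d (u (ℓ * H + h)) a b : ℚ)
  K _ _ := Matrix.of fun a b => (keyEntry d a b : ℚ)
  V _ _ := Matrix.of fun a b => (valueEntry d a b : ℚ)

/-- The tokens for the vectors `v` and `w`. -/
def orthogonalityTokens (N d m : ℕ) (v w : ℕ → ℕ → ℕ) : Matrix (Fin N) (Fin m) ℚ :=
  Matrix.of fun j c => (tokenEntry d v w j c : ℚ)

/-- The number of coordinates where `u` and `v j` are `1` and the vector `w k` is `0`. -/
def agreements (d : ℕ) (u : ℕ → ℕ) (v w : ℕ → ℕ → ℕ) (j k : ℕ) : ℕ :=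
  ∑ b ∈ Finset.range d, u b * v j b * (if k = 0 then 1 else 1 - w k b)

noncomputable section

/-- The attention that token `j` pays to the tokens other than `0`. -/
def attentionShare (N d : ℕ) (u : ℕ → ℕ) (v w : ℕ → ℕ → ℕ) (j : ℕ) : ℝ :=
  (∑ k : Fin N, if (k : ℕ) = 0 then 0 else Real.exp (N * agreements d u v w j k)) /
    ∑ k : Fin N, Real.exp (N * agreements d u v w j k)

section Gadget

variable {N d m L H : ℕ} {u : ℕ → ℕ → ℕ} {v w : ℕ → ℕ → ℕ}

/-- The query matrix is diagonal and the key matrix is a shift by `d`, so each inner sum has a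
single term. Only coordinates up to `2 * d` are constrained, so the formula applies to the residual
stream of every layer and not just to the input. -/
theorem orthogonality_score (hm : 2 * d + 2 ≤ m) (Y : Matrix (Fin N) (Fin m) ℝ)
    (hY : ∀ j (c : Fin m), (c : ℕ) < 2 * d + 1 → Y j c = tokenEntry d v w j c)
    (ℓ : Fin L) (h : Fin H) (j k : Fin N) :
    ∑ b : Fin m, ((orthogonalityWeights N d m L H u).transformer.head ℓ h).Q (Y j) b *
        ((orthogonalityWeights N d m L H u).transformer.head ℓ h).K (Y k) b =
      N * agreements d (u (ℓ * H + h)) v w j k := by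
  have hQ : ∀ b : Fin m, ((orthogonalityWeights N d m L H u).transformer.head ℓ h).Q (Y j) b =
      if (b : ℕ) < d then (N * u (ℓ * H + h) b * v j b : ℝ) else 0 := by
    intro b
    simp only [Weights.transformer, orthogonalityWeights, Matrix.vecMul, dotProduct,
      Matrix.map_apply, Matrix.of_apply]
    rw [Finset.sum_eq_single b]
    · by_cases hb : (b : ℕ) < d
      · rw [hY j b (by omega)]
        simp [queryEntry, tokenEntry, hb]
        ring
      · simp [queryEntry, hb]
    · intro a _ hab
      have : (a : ℕ) ≠ b := fun h => hab (Fin.ext h)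
      simp [queryEntry, this]
    · simp
  have hK : ∀ b : Fin m, (b : ℕ) < d →
      ((orthogonalityWeights N d m L H u).transformer.head ℓ h).K (Y k) b =
      ((if (k : ℕ) = 0 then 1 else 1 - w k b : ℕ) : ℝ) := by
    intro b hb
    simp only [Weights.transformer, orthogonalityWeights, Matrix.vecMul, dotProduct,
      Matrix.map_apply, Matrix.of_apply]
    rw [Finset.sum_eq_single (⟨b + d, by omega⟩ : Fin m)]
    · rw [hY k _ (by simp only; omega)]
      have h₁ : ¬ (b : ℕ) + d < d := by omega
      have h₂ : (b : ℕ) + d < 2 * d := by omega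
      simp [keyEntry, tokenEntry, hb, h₂]
    · intro a _ hab
      have : (a : ℕ) ≠ b + d := fun h => hab (Fin.ext h)
      simp [keyEntry, this]
    · simp
  -- A function on all of `ℕ` is needed to turn the sum over `Fin m` into one over a range, which is
  -- then cut down to `d`.
  obtain ⟨F, hF⟩ : ∃ F : ℕ → ℝ, F = fun b : ℕ => if b < d then (N : ℝ) *
      ((u (ℓ * H + h) b * v j b * (if (k : ℕ) = 0 then 1 else 1 - w k b) : ℕ) : ℝ) else 0 :=
    ⟨_, rfl⟩
  have : ∀ b : Fin m, ((orthogonalityWeights N d m L H u).transformer.head ℓ h).Q (Y j) b *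
        ((orthogonalityWeights N d m L H u).transformer.head ℓ h).K (Y k) b = F b := by
    intro b
    rw [hQ, hF]
    by_cases hb : (b : ℕ) < d
    · rw [hK b hb]
      simp only [hb, if_true]
      push_cast
      ring
    · simp [hb]
  rw [Finset.sum_congr rfl fun b _ => this b, Fin.sum_univ_eq_sum_range F m, hF]
  rw [← Finset.sum_filter, agreements, Nat.cast_sum, Finset.mul_sum]
  refine Finset.sum_congr ?_ fun _ _ => rfl
  ext b
  simp only [Finset.mem_filter, Finset.mem_range]
  omega

/-- The value matrix has a single nonzero entry, which moves the flag to coordinate `2 * d + 1`;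
averaging flags with softmax weights gives the share of the tokens other than `0`. -/
theorem orthogonality_head (hm : 2 * d + 2 ≤ m) (Y : Matrix (Fin N) (Fin m) ℝ)
    (hY : ∀ j (c : Fin m), (c : ℕ) < 2 * d + 1 → Y j c = tokenEntry d v w j c)
    (ℓ : Fin L) (h : Fin H) (j : Fin N) (c : Fin m) :
    ((orthogonalityWeights N d m L H u).transformer.head ℓ h).apply Y j c =
      if (c : ℕ) = 2 * d + 1 then attentionShare N d (u (ℓ * H + h)) v w j else 0 := by
  have hV : ∀ k : Fin N, ((orthogonalityWeights N d m L H u).transformer.head ℓ h).V (Y k) c =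
      if (c : ℕ) = 2 * d + 1 then (if (k : ℕ) = 0 then 0 else 1 : ℝ) else 0 := by
    intro k
    simp only [Weights.transformer, orthogonalityWeights, Matrix.vecMul, dotProduct,
      Matrix.map_apply, Matrix.of_apply]
    rw [Finset.sum_eq_single (⟨2 * d, by omega⟩ : Fin m)]
    · rw [hY k _ (by simp)]
      have h₁ : ¬ 2 * d < d := by omega
      by_cases hc : (c : ℕ) = 2 * d + 1 <;> by_cases hk : (k : ℕ) = 0 <;>
        simp [valueEntry, tokenEntry, h₁, hc, hk]
    · intro a _ hab
      have : (a : ℕ) ≠ 2 * d := fun h => hab (Fin.ext h)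
      simp [valueEntry, this]
    · simp
  simp only [AttentionHead.apply, Matrix.mul_apply, Matrix.of_apply, Matrix.transpose_apply, hV,
    softmax, orthogonality_score hm Y hY]
  split_ifs
  · rw [attentionShare, Finset.sum_div]
    refine Finset.sum_congr rfl fun k _ => ?_
    split_ifs <;> simp
  · simp

/-- Layers do not interact, because the one coordinate they modify is read by no head. -/
theorem orthogonality_eval (hm : 2 * d + 2 ≤ m) (j : Fin N) (c : Fin m) (hc : (c : ℕ) = 2 * d + 1) :
    (orthogonalityWeights N d m L H u).transformer.eval
        ((orthogonalityTokens N d m v w).map (fun r : ℚ => (r : ℝ))) j c =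
      ∑ ℓ : Fin L, ∑ h : Fin H, attentionShare N d (u (ℓ * H + h)) v w j := by
  set T := (orthogonalityWeights N d m L H u).transformer with hT
  set X := (orthogonalityTokens N d m v w).map (fun r : ℚ => (r : ℝ)) with hX
  have hX' : ∀ j c, X j c = tokenEntry d v w j c := by
    intro j c
    simp [hX, orthogonalityTokens]
  -- Induction over the remaining layers for an arbitrary stream `Y` that still agrees with the
  -- tokens on the coordinates that are read.
  have key : ∀ (l : List (Fin L)) (Y : Matrix (Fin N) (Fin m) ℝ),
      (∀ j (c : Fin m), (c : ℕ) < 2 * d + 1 → Y j c = tokenEntry d v w j c) →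
      l.foldl (fun Y ℓ => T.layer ℓ Y) Y j c =
        Y j c + (l.map fun ℓ : Fin L =>
          ∑ h : Fin H, attentionShare N d (u (ℓ * H + h)) v w j).sum := by
    intro l
    induction l with
    | nil => intro Y _; simp
    | cons ℓ l ih =>
      intro Y hY
      have hl : ∀ j (c : Fin m), T.layer ℓ Y j c = Y j c +
          if (c : ℕ) = 2 * d + 1 then ∑ h : Fin H, attentionShare N d (u (ℓ * H + h)) v w j
          else 0 := by
        intro j c
        have : T.layer ℓ Y j c = (Y + ∑ h, (T.head ℓ h).apply Y) j c := rfl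
        rw [this, Matrix.add_apply, Matrix.sum_apply]
        simp only [hT, orthogonality_head hm Y hY]
        split_ifs <;> simp
      rw [List.foldl_cons, ih, hl, if_pos hc, List.map_cons, List.sum_cons, add_assoc]
      intro j' c' hc'
      rw [hl, if_neg (by omega), add_zero, hY j' c' hc']
  have h₁ : T.eval X j c = Fin.foldl L (fun Y ℓ => T.layer ℓ Y) X j c := rfl
  rw [h₁, Fin.foldl_eq_foldl_finRange, key _ _ (fun j c _ => hX' j c), hX', tokenEntry]
  -- The accumulating coordinate starts at `0`, since it lies beyond all token data.
  have h₂ : ¬ 2 * d + 1 < d := by omega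
  have h₃ : ¬ 2 * d + 1 < 2 * d := by omega
  simp [hc, h₂, h₃, Fin.sum_univ_def]

/-! ### The softmax gap between orthogonal and other triples -/

theorem attentionShare_nonneg (u : ℕ → ℕ) (j : ℕ) : 0 ≤ attentionShare N d u v w j := by
  refine div_nonneg (Finset.sum_nonneg fun k _ => ?_) (Finset.sum_nonneg fun k _ => by positivity)
  split_ifs <;> positivity

/-- Wherever `u` and `v j` are both nonzero, orthogonality forces `w k` to vanish, just as it does
for the zero vector of token `0`. -/
theorem agreements_eq {u : ℕ → ℕ} {j k : ℕ} (h : ∀ b < d, u b * v j b * w k b = 0) :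
    agreements d u v w j k = agreements d u v w j 0 := by
  refine Finset.sum_congr rfl fun b hb => ?_
  have := h b (Finset.mem_range.1 hb)
  rcases mul_eq_zero.1 this with h | h <;> simp [h]

/-- Token `0` is maximal in every coordinate, and a common nonzero coordinate makes the comparison
strict there. Being an integer, the deficit is at least `1`. -/
theorem agreements_lt {u : ℕ → ℕ} {j k : ℕ} (hk : k ≠ 0) {b : ℕ} (hb : b < d)
    (h : u b * v j b * w k b ≠ 0) :
    agreements d u v w j k < agreements d u v w j 0 := by
  refine Finset.sum_lt_sum (fun b _ => Nat.mul_le_mul_left _ ?_) ⟨b, Finset.mem_range.2 hb, ?_⟩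
  · split_ifs <;> omega
  · obtain ⟨h₁, h₂⟩ := mul_ne_zero_iff.1 h
    have : 1 - w k b = 0 := by omega
    simp only [hk, if_false, this, if_true]
    simpa using Nat.pos_of_ne_zero h₁

/-- A token that belongs to an orthogonal triple pays at least half of its attention to tokens other
than `0`. -/
theorem half_le_attentionShare {u : ℕ → ℕ} {j k : ℕ} (hk : k ≠ 0) (hkN : k < N)
    (h : ∀ b < d, u b * v j b * w k b = 0) :
    1 / 2 ≤ attentionShare N d u v w j := by
  obtain ⟨n, rfl⟩ : ∃ n, N = n + 1 := ⟨N - 1, by omega⟩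
  have h₁ : (∑ i : Fin (n + 1), Real.exp ((n + 1 : ℕ) * agreements d u v w j i)) =
      Real.exp ((n + 1 : ℕ) * agreements d u v w j 0) + ∑ i : Fin (n + 1),
        if (i : ℕ) = 0 then 0 else Real.exp ((n + 1 : ℕ) * agreements d u v w j i) := by
    rw [Fin.sum_univ_succ, Fin.sum_univ_succ]
    simp
  -- The orthogonal partner `k` alone matches the weight of token `0`.
  have h₂ : Real.exp ((n + 1 : ℕ) * agreements d u v w j 0) ≤ ∑ i : Fin (n + 1),
        if (i : ℕ) = 0 then 0 else Real.exp ((n + 1 : ℕ) * agreements d u v w j i) := by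
    refine le_trans ?_ (Finset.single_le_sum (fun i _ => ?_) (Finset.mem_univ ⟨k, hkN⟩))
    · simp only [hk, if_false, agreements_eq h, le_refl]
    · split_ifs <;> positivity
  have h₃ := Real.exp_pos ((n + 1 : ℕ) * agreements d u v w j 0)
  rw [attentionShare, h₁, div_le_div_iff₀ (by norm_num) (by linarith)]
  linarith

/-- A token that belongs to no orthogonal triple pays almost all of its attention to token `0`. -/
theorem attentionShare_le {u : ℕ → ℕ} {j : ℕ}
    (h : ∀ k, k ≠ 0 → k < N → ∃ b < d, u b * v j b * w k b ≠ 0) :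
    attentionShare N d u v w j ≤ N * Real.exp (-N) := by
  rcases Nat.eq_zero_or_pos N with rfl | hN
  · simp [attentionShare]
  have h₁ : Real.exp (N * agreements d u v w j 0) ≤
      ∑ i : Fin N, Real.exp (N * agreements d u v w j i) := by
    have := Finset.single_le_sum (s := Finset.univ)
      (f := fun i : Fin N => Real.exp (N * agreements d u v w j i))
      (fun i _ => (Real.exp_pos _).le) (Finset.mem_univ ⟨0, hN⟩)
    exact this
  -- A deficit of one agreement, scaled by the factor `N` in the query matrix, costs `exp (-N)`;
  -- there are at most `N` such tokens.
  have h₂ : (∑ k : Fin N, if (k : ℕ) = 0 then 0 else Real.exp (N * agreements d u v w j k)) ≤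
      ∑ k : Fin N, Real.exp (-N) * Real.exp (N * agreements d u v w j 0) := by
    refine Finset.sum_le_sum fun k _ => ?_
    split_ifs with hk
    · positivity
    · obtain ⟨b, hb, hb'⟩ := h k hk k.2
      have h₃ : (agreements d u v w j k : ℝ) + 1 ≤ agreements d u v w j 0 := by
        exact_mod_cast agreements_lt hk hb hb'
      rw [← Real.exp_add]
      apply Real.exp_le_exp.2
      have : (0 : ℝ) < N := by exact_mod_cast hN
      nlinarith
  have h₃ := Real.exp_pos (N * agreements d u v w j 0)
  rw [attentionShare, div_le_iff₀ (by linarith)]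
  refine h₂.trans ?_
  rw [Finset.sum_const, Finset.card_univ, Fintype.card_fin, nsmul_eq_mul, ← mul_assoc]
  exact mul_le_mul_of_nonneg_left h₁ (by positivity)

/-- Token `j` is orthogonal to some vector `u` and some token `k` other than `0`. -/
def InOrthogonalTriple (N d R : ℕ) (u v w : ℕ → ℕ → ℕ) (j : ℕ) : Prop :=
  ∃ r < R, ∃ k, k ≠ 0 ∧ k < N ∧ ∀ b < d, u r b * v j b * w k b = 0

/-- All shares are nonnegative, so the one head that carries the right `u` suffices. Vector number
`r` sits in layer `r / H`, head `r % H`. -/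
theorem orthogonality_eval_of_triple (hm : 2 * d + 2 ≤ m) (j : Fin N) (c : Fin m)
    (hc : (c : ℕ) = 2 * d + 1) (h : InOrthogonalTriple N d (L * H) u v w j) :
    1 / 2 ≤ (orthogonalityWeights N d m L H u).transformer.eval
        ((orthogonalityTokens N d m v w).map (fun r : ℚ => (r : ℝ))) j c := by
  rw [orthogonality_eval hm j c hc]
  obtain ⟨r, hr, k, hk, hkN, hb⟩ := h
  have hH : 0 < H := by
    rcases Nat.eq_zero_or_pos H with rfl | h
    · simp at hr
    · exact h
  have h₁ : r / H < L := (Nat.div_lt_iff_lt_mul hH).2 hr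
  have h₂ : r / H * H + r % H = r := Nat.div_add_mod' r H
  refine le_trans ?_ (Finset.single_le_sum
    (fun ℓ _ => Finset.sum_nonneg fun h _ => attentionShare_nonneg _ _)
    (Finset.mem_univ (⟨r / H, h₁⟩ : Fin L)))
  refine le_trans ?_ (Finset.single_le_sum (fun h _ => attentionShare_nonneg _ _)
    (Finset.mem_univ (⟨r % H, Nat.mod_lt _ hH⟩ : Fin H)))
  simp only [h₂]
  exact half_le_attentionShare hk hkN hb

theorem orthogonality_eval_of_no_triple (hm : 2 * d + 2 ≤ m) (j : Fin N) (c : Fin m)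
    (hc : (c : ℕ) = 2 * d + 1) (h : ¬ InOrthogonalTriple N d (L * H) u v w j) :
    (orthogonalityWeights N d m L H u).transformer.eval
        ((orthogonalityTokens N d m v w).map (fun r : ℚ => (r : ℝ))) j c ≤
      L * H * (N * Real.exp (-N)) := by
  rw [orthogonality_eval hm j c hc]
  refine (Finset.sum_le_sum fun ℓ _ => Finset.sum_le_sum (g := fun _ => N * Real.exp (-N))
    fun h' _ => attentionShare_le ?_).trans ?_
  · intro k hk hkN
    by_contra! hcon
    refine h ⟨ℓ * H + h', ?_, k, hk, hkN, hcon⟩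
    calc (ℓ : ℕ) * H + h' < ℓ * H + H := by omega
      _ = (ℓ + 1) * H := by ring
      _ ≤ L * H := Nat.mul_le_mul_right _ ℓ.2
  · simp [mul_assoc]

end Gadget

end

/-! ## The reduction

Arrays `0`, …, `3` hold the 3-OV instance.  The registers `0`, …, `6` in array `6` hold the number `M`
of transformers, the index `i` of the current transformer, `N`, `m`, `L`, `H`, and the number `B` of
blocks that the second and the third family are divided into; register `0` in array `7` is a loop
counter. The algorithm that computes transformers runs in the arrays `9`, `11`, `13`, …. -/

namespace Reduction

/-- The parameters of a 3-OV instance and of the transformers that it is reduced to. -/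
structure Params where
  (n d N m L H : ℕ)

/-- The number of blocks that the second and the third family are divided into. -/
def Params.B (π : Params) : ℕ := π.n / (π.N - 1) + 1

/-- The number of transformers. -/
def Params.M (π : Params) : ℕ := (π.n / (π.L * π.H) + 1) * (π.B * π.B)

def Params.registers (π : Params) (i : ℕ) : ℕ → ℕ
  | 0 => π.M
  | 1 => i
  | 2 => π.N
  | 3 => π.m
  | 4 => π.L
  | 5 => π.H
  | 6 => π.B
  | _ => 0

/-- The array that holds the memory of array `a` for the algorithm that computes transformers. -/
def bank (a : ℕ) : ℕ := 2 * a + 9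

theorem bank_injective : bank.Injective := fun a b h => by simpa [bank] using h

/-- The memory when transformer `i` is processed, the counter is `t` and the answer so far is `r`. -/
structure Mem (π : Params) (inp : State) (i t r : ℕ) (s : State) : Prop where
  input : ∀ a < 4, s a = inp a
  reg : s 6 = π.registers i
  counter : s 7 = fun x => if x = 0 then t else 0
  out : s 5 = fun x => if x = 0 then r else 0

/-- The parts `i, i + 1, …` of the simulated memory have not been used. -/
def Fresh (M i : ℕ) (s : State) : Prop := ∀ a x, i ≤ x % M → s (bank a) x = 0

/-- The input contains the parameters, and all numbers have at most `β` bits. -/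
structure Fits (π : Params) (inp : State) (β : ℕ) : Prop where
  n_eq : inp 0 0 = π.n
  d_eq : inp 0 1 = π.d
  pos : 1 ≤ β
  inp_size : ∀ a < 4, ∀ x, (inp a x).size ≤ β
  M_size : π.M.size ≤ β
  N_size : π.N.size ≤ β
  m_size : π.m.size ≤ β
  L_size : π.L.size ≤ β
  H_size : π.H.size ≤ β
  B_size : π.B.size ≤ β
  tokens_size : (π.N * π.m).size ≤ β
  weights_size : (π.L * (π.H * (π.m * π.m))).size ≤ β

/-- The arrays that hold small numbers. -/
def IsSmall (a : ℕ) : Prop := a < 4 ∨ a = 6 ∨ a = 7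

/-! ### Memory invariants and single writes -/

section Memory

variable {π : Params} {inp : State} {β i t r : ℕ} {s : State}

theorem Mem.size_le (h : Mem π inp i t r s) (hf : Fits π inp β) (hi : i ≤ π.M) (ht : t.size ≤ β)
    (a : ℕ) (ha : IsSmall a) (x : ℕ) : (s a x).size ≤ β := by
  rcases ha with ha | rfl | rfl
  · rw [h.input a ha]
    exact hf.inp_size a ha x
  · rw [h.reg]
    have := (Nat.size_le_size hi).trans hf.M_size
    unfold Params.registers
    split <;> simp [hf.M_size, hf.N_size, hf.m_size, hf.L_size, hf.H_size, hf.B_size, this]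
  · rw [h.counter]
    dsimp only
    split_ifs <;> simp [ht]

theorem Mem.cost_le (h : Mem π inp i t r s) (hf : Fits π inp β) (hi : i ≤ π.M) (ht : t.size ≤ β)
    {e : Expr} (he : e.Reads IsSmall) : e.cost s ≤ e.weight * β :=
  Expr.cost_le hf.pos (h.size_le hf hi ht) he

theorem Mem.M_eq (h : Mem π inp i t r s) : s 6 0 = π.M := by rw [h.reg]; rfl
theorem Mem.i_eq (h : Mem π inp i t r s) : s 6 1 = i := by rw [h.reg]; rfl
theorem Mem.N_eq (h : Mem π inp i t r s) : s 6 2 = π.N := by rw [h.reg]; rfl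
theorem Mem.m_eq (h : Mem π inp i t r s) : s 6 3 = π.m := by rw [h.reg]; rfl
theorem Mem.L_eq (h : Mem π inp i t r s) : s 6 4 = π.L := by rw [h.reg]; rfl
theorem Mem.H_eq (h : Mem π inp i t r s) : s 6 5 = π.H := by rw [h.reg]; rfl
theorem Mem.B_eq (h : Mem π inp i t r s) : s 6 6 = π.B := by rw [h.reg]; rfl
theorem Mem.t_eq (h : Mem π inp i t r s) : s 7 0 = t := by rw [h.counter]; rfl
theorem Mem.n_eq (h : Mem π inp i t r s) (hf : Fits π inp β) : s 0 0 = π.n := by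
  rw [h.input 0 (by norm_num), hf.n_eq]
theorem Mem.d_eq (h : Mem π inp i t r s) (hf : Fits π inp β) : s 0 1 = π.d := by
  rw [h.input 0 (by norm_num), hf.d_eq]

theorem Mem.set_counter (h : Mem π inp i t r s) (y : ℕ) : Mem π inp i y r (s.write 7 0 y) where
  input a ha := by rw [← h.input a ha]; ext x; simp [State.write]; omega
  reg := by rw [← h.reg]; ext x; simp [State.write]
  counter := by
    ext x
    have := congrFun h.counter x
    by_cases hx : x = 0 <;> simp_all [State.write]
  out := by rw [← h.out]; ext x; simp [State.write]

theorem Mem.set_out (h : Mem π inp i t r s) (y : ℕ) : Mem π inp i t y (s.write 5 0 y) where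
  input a ha := by rw [← h.input a ha]; ext x; simp [State.write]; omega
  reg := by rw [← h.reg]; ext x; simp [State.write]
  counter := by rw [← h.counter]; ext x; simp [State.write]
  out := by
    ext x
    have := congrFun h.out x
    by_cases hx : x = 0 <;> simp_all [State.write]

theorem Mem.set_index (h : Mem π inp i t r s) (y : ℕ) : Mem π inp y t r (s.write 6 1 y) where
  input a ha := by rw [← h.input a ha]; ext x; simp [State.write]; omega
  reg := by
    ext x
    have := congrFun h.reg x
    rcases x with _ | _ | _ | _ | _ | _ | _ | x <;> simp_all [State.write, Params.registers]
  counter := by rw [← h.counter]; ext x; simp [State.write]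
  out := by rw [← h.out]; ext x; simp [State.write]

/-- The memory while transformer `i` is processed; the simulated memory is `v`. -/
structure Work (π : Params) (inp : State) (i t r : ℕ) (v s : State) : Prop where
  mem : Mem π inp i t r s
  holds : Holds bank π.M i s v
  fresh : Fresh π.M (i + 1) s

theorem Fresh.of_agreeOff {s s' : State} {M : ℕ} (h : Fresh M (i + 1) s)
    (h' : AgreeOff bank M i s s') : Fresh M (i + 1) s' := by
  intro a x hx
  rw [h' _ _ (Or.inr (by omega))]
  exact h a x hx

/-- The simulated arrays are numbered from `9` on, so the simulation cannot touch the instance, the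
registers, the counter or the answer. -/
theorem Mem.of_agreeOff {s s' : State} {M : ℕ} (h : Mem π inp i t r s)
    (h' : AgreeOff bank M i s s') : Mem π inp i t r s' := by
  have key : ∀ a < 9, s' a = s a := by
    intro a ha
    ext x
    exact h' a x (Or.inl fun b => by simp only [bank]; omega)
  exact ⟨fun a ha => (key a (by omega)).trans (h.input a ha), (key 6 (by omega)).trans h.reg,
    (key 7 (by omega)).trans h.counter, (key 5 (by omega)).trans h.out⟩

variable {v : State}

theorem Work.of_holds {v' s' : State} (h : Work π inp i t r v s) (h₁ : Holds bank π.M i s' v')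
    (h₂ : AgreeOff bank π.M i s s') : Work π inp i t r v' s' :=
  ⟨h.mem.of_agreeOff h₂, h₁, h.fresh.of_agreeOff h₂⟩

theorem bank_ne {a b : ℕ} (hb : b < 9) : bank a ≠ b := by simp only [bank]; omega

theorem Work.write_bank (h : Work π inp i t r v s) (hi : i < π.M) (a x y : ℕ) :
    Work π inp i t r (v.write a x y) (s.write (bank a) (x * π.M + i) y) := by
  obtain ⟨h₁, h₂⟩ := h.holds.write bank_injective (fun a => bank_ne (by norm_num)) hi a x y
  exact h.of_holds h₁ h₂

theorem Work.set_counter (h : Work π inp i t r v s) (y : ℕ) :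
    Work π inp i y r v (s.write 7 0 y) := by
  have key : ∀ a, s.write 7 0 y (bank a) = s (bank a) := by
    intro a; ext x; simp [State.write, bank_ne]
  refine ⟨h.mem.set_counter y, ⟨?_, ?_, ?_⟩, ?_⟩
  · rw [← h.holds.stride]; simp [State.write]
  · rw [← h.holds.part]; simp [State.write]
  · intro a x; rw [key, h.holds.cell]
  · intro a x hx; rw [key, h.fresh a x hx]

theorem Work.set_out (h : Work π inp i t r v s) (y : ℕ) :
    Work π inp i t y v (s.write 5 0 y) := by
  have key : ∀ a, s.write 5 0 y (bank a) = s (bank a) := by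
    intro a; ext x; simp [State.write, bank_ne]
  refine ⟨h.mem.set_out y, ⟨?_, ?_, ?_⟩, ?_⟩
  · rw [← h.holds.stride]; simp [State.write]
  · rw [← h.holds.part]; simp [State.write]
  · intro a x; rw [key, h.holds.cell]
  · intro a x hx; rw [key, h.fresh a x hx]

theorem Work.store_bank (h : Work π inp i t r v s) (hf : Fits π inp β) (hi : i < π.M)
    (ht : t.size ≤ β) (a : ℕ) {x y : Expr} (hx : x.Reads IsSmall) (hy : y.Reads IsSmall) :
    Runs (.store (bank a) x.addr y) s ((x.addr.weight + y.weight + 1) * β)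
      (Work π inp i t r (v.write a (x.eval s) (y.eval s))) := by
  refine (Runs.store ?_).mono_time (T₁ := x.addr.cost s + y.cost s + 1) ?_
  · rw [Expr.eval_addr, h.mem.M_eq, h.mem.i_eq]
    exact h.write_bank hi a _ _
  · have h₁ := h.mem.cost_le hf hi.le ht (e := x.addr) (by simp [hx, IsSmall])
    have h₂ := h.mem.cost_le hf hi.le ht hy
    have h₃ := hf.pos
    rw [add_mul, add_mul]
    omega

theorem Work.store_counter (h : Work π inp i t r v s) (hf : Fits π inp β) (hi : i < π.M)
    (ht : t.size ≤ β) {y : Expr} (hy : y.Reads IsSmall) :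
    Runs (.store 7 0 y) s ((y.weight + 2) * β) (Work π inp i (y.eval s) r v) := by
  refine (Runs.store ?_).mono_time ?_
  · exact h.set_counter _
  · have h₂ := h.mem.cost_le hf hi.le ht hy
    have h₃ := hf.pos
    have h₄ : (0 : Expr).cost s = 1 := rfl
    rw [add_mul]
    omega

end Memory

/-! ### Filling an array with the codes of natural numbers -/

/-- The codes of the rational numbers `F 0, …, F (b - 1)`. -/
def codeArray (F : ℕ → ℕ) (b x : ℕ) : ℕ :=
  if x / 3 < b then (if x % 3 = 0 then F (x / 3) else if x % 3 = 2 then 1 else 0) else 0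

theorem ratArray_natCast {b : ℕ} (F : ℕ → ℕ) :
    ratArray (fun p : Fin b => (F p : ℚ)) = codeArray F b := by
  ext x
  simp only [ratArray, codeArray]
  split_ifs with h₁ h₂ h₃
  · have : (⟨x % 3, Nat.mod_lt x (by norm_num)⟩ : Fin 3) = 0 := Fin.ext h₂
    simp only [this]
    simp [ratCode]
  · have : (⟨x % 3, Nat.mod_lt x (by norm_num)⟩ : Fin 3) = 2 := Fin.ext h₃
    simp only [this]
    simp [ratCode]
  · have : (⟨x % 3, Nat.mod_lt x (by norm_num)⟩ : Fin 3) = 1 := Fin.ext (by simp; omega)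
    simp only [this]
    simp [ratCode]
  · rfl

/-- Two writes per number suffice: the middle cell of a code is the negative part of the numerator,
and it is already `0`. -/
theorem write_codeArray (v : State) (a t : ℕ) (F : ℕ → ℕ) :
    State.write (State.write (Function.update v a (codeArray F t)) a (3 * t) (F t)) a (3 * t + 2) 1 =
      Function.update v a (codeArray F (t + 1)) := by
  ext b x
  by_cases hb : b = a
  · subst hb
    simp only [State.write, Function.update_self, true_and, codeArray]
    by_cases h₁ : x = 3 * t + 2
    · rw [if_pos h₁, if_pos (by omega), if_neg (by omega), if_pos (by omega)]
    · rw [if_neg h₁]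
      by_cases h₂ : x = 3 * t
      · rw [if_pos h₂, if_pos (by omega), if_pos (by omega)]
        congr 1
        omega
      · rw [if_neg h₂]
        by_cases h₃ : x / 3 < t
        · rw [if_pos h₃, if_pos (show x / 3 < t + 1 by omega)]
        · rw [if_neg h₃]
          by_cases h₄ : x / 3 < t + 1
          · rw [if_pos h₄, if_neg (by omega), if_neg (by omega)]
          · rw [if_neg h₄]
  · simp [State.write, hb]

/-- The loop counter. -/
def counter : Expr := .load 7 0

/-- Write the codes of `bnd` numbers into array `bank a`, where `E` is the number at the position that
is given by the counter. -/
def fill (a : ℕ) (bnd E : Expr) : Prog :=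
  .seq (.store 7 0 0) <| .loop (bnd - counter) <|
    .seq (.store (bank a) (3 * counter).addr E) <|
      .seq (.store (bank a) (3 * counter + 2).addr 1) (.store 7 0 (counter + 1))

def fillWeight (bnd E : Expr) : ℕ :=
  (bnd - counter).weight + (3 * counter).addr.weight + E.weight +
    (3 * counter + 2).addr.weight + (1 : Expr).weight + (counter + 1).weight + 20

theorem reads_counter : counter.Reads IsSmall := ⟨by simp [IsSmall], trivial⟩

section Fill

variable {π : Params} {inp : State} {β i t r b : ℕ} {s v : State}

theorem Work.fill (h : Work π inp i t r v s) (hf : Fits π inp β) (hi : i < π.M) (ht : t.size ≤ β)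
    {a : ℕ} (ha : v a = fun _ => 0) {bnd E : Expr} (hbnd : bnd.Reads IsSmall)
    (hE : E.Reads IsSmall) (hb : b.size ≤ β) (hbnd' : ∀ t s, Mem π inp i t r s → bnd.eval s = b)
    {F : ℕ → ℕ} (hE' : ∀ t s, t < b → Mem π inp i t r s → E.eval s = F t) :
    Runs (fill a bnd E) s (fillWeight bnd E * β * (b + 1))
      (Work π inp i b r (Function.update v a (codeArray F b))) := by
  have hc := reads_counter
  -- A blank array is the code of the empty list, which starts the loop invariant.
  have hv : v = Function.update v a (codeArray F 0) := by
    ext b x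
    by_cases hb : b = a
    · subst hb; simp [ha, codeArray]
    · simp [hb]
  have h₀ := h.store_counter hf hi ht (y := 0) trivial
  refine (h₀.seq fun s h => Runs.loop
    (I := fun t s => Work π inp i t r (Function.update v a (codeArray F t)) s)
    (κ := ((bnd - counter).weight + 1) * β)
    (c := fun _ => ((3 * counter).addr.weight + E.weight + 1) * β +
      (((3 * counter + 2).addr.weight + (1 : Expr).weight + 1) * β +
        ((counter + 1).weight + 2) * β)) (Nat.zero_le b) ?_ ?_ ?_).mono_time ?_
  · intro t s _ htb h
    have ht : t.size ≤ β := (Nat.size_le_size htb.le).trans hb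
    have htt : counter.eval s = t := h.mem.t_eq
    refine ⟨?_, ?_, ?_⟩
    · simp only [Expr.eval_sub, hbnd' t s h.mem, htt]; omega
    · have := h.mem.cost_le hf hi.le ht (e := bnd - counter) ⟨hbnd, hc⟩
      have := hf.pos
      rw [add_mul]
      omega
    · refine (h.store_bank hf hi ht a (x := 3 * counter) (y := E) ⟨trivial, hc⟩ hE).seq fun s₁ h₁ =>
        (h₁.store_bank hf hi ht a (x := 3 * counter + 2) (y := 1) ⟨⟨trivial, hc⟩, trivial⟩
          trivial).seq fun s₂ h₂ =>
          (h₂.store_counter hf hi ht (y := counter + 1) ⟨hc, trivial⟩).mono le_rfl fun s₃ h₃ => ?_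
      have e₁ : counter.eval s₁ = t := h₁.mem.t_eq
      have e₂ : counter.eval s₂ = t := h₂.mem.t_eq
      simpa only [Expr.eval_mul, Expr.eval_add, Expr.eval_ofNat, htt, e₁, e₂, hE' t s htb h.mem,
        write_codeArray] using h₃
  · intro s h
    have htt : counter.eval s = b := h.mem.t_eq
    refine ⟨?_, ?_⟩
    · simp only [Expr.eval_sub, hbnd' b s h.mem, htt]; omega
    · have := h.mem.cost_le hf hi.le hb (e := bnd - counter) ⟨hbnd, hc⟩
      have := hf.pos
      rw [add_mul]
      omega
  · rw [← hv]
    exact h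
  · rw [Finset.sum_const, Nat.card_Ico, smul_eq_mul, fillWeight]
    have : (0 : Expr).weight = 1 := rfl
    rw [this]
    generalize (bnd - counter).weight = w₁
    generalize (3 * counter).addr.weight = w₂
    generalize E.weight = w₃
    generalize (3 * counter + 2).addr.weight = w₄
    generalize (1 : Expr).weight = w₅
    generalize (counter + 1).weight = w₆
    have e : (w₁ + w₂ + w₃ + w₄ + w₅ + w₆ + 20) * β * (b + 1) =
        (1 + 2) * β + (b * ((w₁ + 1) * β + ((w₂ + w₃ + 1) * β + ((w₄ + w₅ + 1) * β +
          (w₆ + 2) * β))) + (w₁ + 1) * β) +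
          ((w₂ + w₃ + w₄ + w₅ + w₆) * β + (16 + 15 * b) * β) := by ring
    rw [Nat.sub_zero, e]
    exact Nat.le_add_right _ _

end Fill

/-! ### The transformer number `i` -/

section Instance

variable (π : Params) (inp : State) (i : ℕ)

/-- The vector of the first family that is given to a head. -/
def headVec (h c : ℕ) : ℕ := inp 1 ((i / (π.B * π.B) * (π.L * π.H) + h) % π.n * π.d + c)

/-- The vector of the second family that is given to a token. -/
def rowVec (j c : ℕ) : ℕ := inp 2 ((i / π.B % π.B * (π.N - 1) + (j - 1)) % π.n * π.d + c)

/-- The vector of the third family that is given to a token. -/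
def colVec (j c : ℕ) : ℕ := inp 3 ((i % π.B * (π.N - 1) + (j - 1)) % π.n * π.d + c)

def weights : Weights π.m π.L π.H :=
  orthogonalityWeights π.N π.d π.m π.L π.H (headVec π inp i)

def tokens : Matrix (Fin π.N) (Fin π.m) ℚ :=
  orthogonalityTokens π.N π.d π.m (rowVec π inp i) (colVec π inp i)

end Instance

/-! ### Expressions for the entries of tokens and weights -/

def nE : Expr := .load 0 0
def dE : Expr := .load 0 1
def indexE : Expr := .load 6 1
def NE : Expr := .load 6 2
def mE : Expr := .load 6 3
def LE : Expr := .load 6 4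
def HE : Expr := .load 6 5
def BE : Expr := .load 6 6
-- Coordinates of a position in the flattened weights. Heads are numbered through all layers, hence
-- the plain quotient in `headE`.
def rowE : Expr := .mod (counter / mE) mE
def colE : Expr := .mod counter mE
def headE : Expr := counter / (mE * mE)

def headVecE : Expr :=
  .load 1 (.mod (indexE / (BE * BE) * (LE * HE) + headE) nE * dE + rowE)

def rowVecE : Expr :=
  .load 2 (.mod (.mod (indexE / BE) BE * (NE - 1) + (counter / mE - 1)) nE * dE + colE)

def colVecE : Expr :=
  .load 3 (.mod (.mod indexE BE * (NE - 1) + (counter / mE - 1)) nE * dE + (colE - dE))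

/-- Case distinctions become products of indicators. For token `0` the indicator suppresses
`colVecE`, so that the complement is `1`. The truncated `j - 1` there gives it the same `v` as token
`1`, which is harmless since output rows are read only from token `1` on. -/
def tokenE : Expr :=
  .lt colE dE * rowVecE +
    (1 - .lt colE dE) * .lt colE (2 * dE) * (1 - .lt 0 (counter / mE) * colVecE) +
    .eq colE (2 * dE) * .lt 0 (counter / mE)

def queryE : Expr := .eq rowE colE * .lt rowE dE * (NE * headVecE)
def keyE : Expr := .eq rowE (colE + dE) * .lt colE dE
def valueE : Expr := .eq rowE (2 * dE) * .eq colE (2 * dE + 1)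
def tokensE : Expr := NE * mE
def weightsE : Expr := LE * (HE * (mE * mE))

section Eval

variable {π : Params} {inp : State} {β i t r : ℕ} {s : State}

theorem eval_tokenE (h : Mem π inp i t r s) (hf : Fits π inp β) :
    tokenE.eval s =
      tokenEntry π.d (rowVec π inp i) (colVec π inp i) (t / π.m) (t % π.m) := by
  simp only [tokenE, colE, rowVecE, colVecE, counter, mE, dE, indexE, BE, NE, nE, Expr.eval_add,
    Expr.eval_sub, Expr.eval_mul, Expr.eval_div, Expr.eval_mod, Expr.eval_lt, Expr.eval_eq,
    Expr.eval_load, Expr.eval_ofNat, h.t_eq, h.m_eq, h.B_eq, h.N_eq, h.i_eq, h.n_eq hf, h.d_eq hf,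
    h.input 2 (by norm_num), h.input 3 (by norm_num), tokenEntry, rowVec, colVec]
  generalize t / π.m = j
  generalize t % π.m = c
  by_cases h₁ : c < π.d
  · have h₂ : c ≠ 2 * π.d := by omega
    simp [h₁, h₂]
  · by_cases h₂ : c < 2 * π.d
    · have h₃ : c ≠ 2 * π.d := by omega
      by_cases hj : j = 0
      · simp [h₁, h₂, h₃, hj]
      · simp [h₁, h₂, h₃, hj, Nat.pos_of_ne_zero hj]
    · by_cases hj : j = 0
      · simp [h₁, h₂, hj]
      · simp [h₁, h₂, hj, Nat.pos_of_ne_zero hj]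

theorem eval_queryE (h : Mem π inp i t r s) (hf : Fits π inp β) :
    queryE.eval s =
      queryEntry π.N π.d (headVec π inp i (t / (π.m * π.m))) (t / π.m % π.m) (t % π.m) := by
  simp only [queryE, rowE, colE, headE, headVecE, counter, mE, dE, indexE, BE, NE, LE, HE, nE,
    Expr.eval_add, Expr.eval_mul, Expr.eval_div, Expr.eval_mod, Expr.eval_lt, Expr.eval_eq,
    Expr.eval_load, Expr.eval_ofNat, h.t_eq, h.m_eq, h.B_eq, h.N_eq, h.i_eq, h.n_eq hf, h.d_eq hf,
    h.L_eq, h.H_eq, h.input 1 (by norm_num), queryEntry, headVec]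
  generalize t / π.m % π.m = a
  generalize t % π.m = b
  by_cases h₁ : a = b <;> by_cases h₂ : a < π.d <;> simp [h₁, h₂]

theorem eval_keyE (h : Mem π inp i t r s) (hf : Fits π inp β) :
    keyE.eval s = keyEntry π.d (t / π.m % π.m) (t % π.m) := by
  simp only [keyE, rowE, colE, counter, mE, dE, Expr.eval_add, Expr.eval_mul, Expr.eval_div,
    Expr.eval_mod, Expr.eval_lt, Expr.eval_eq, Expr.eval_load, Expr.eval_ofNat, h.t_eq, h.m_eq,
    h.d_eq hf, keyEntry]
  split_ifs <;> simp_all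

theorem eval_valueE (h : Mem π inp i t r s) (hf : Fits π inp β) :
    valueE.eval s = valueEntry π.d (t / π.m % π.m) (t % π.m) := by
  simp only [valueE, rowE, colE, counter, mE, dE, Expr.eval_add, Expr.eval_mul, Expr.eval_div,
    Expr.eval_mod, Expr.eval_eq, Expr.eval_load, Expr.eval_ofNat, h.t_eq, h.m_eq,
    h.d_eq hf, valueEntry]
  split_ifs <;> simp_all

end Eval

theorem reads_tokenE : tokenE.Reads IsSmall := by
  simp [tokenE, colE, rowVecE, colVecE, counter, mE, dE, indexE, BE, NE, nE, IsSmall]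

theorem reads_queryE : queryE.Reads IsSmall := by
  simp [queryE, rowE, colE, headE, headVecE, counter, mE, dE, indexE, BE, NE, LE, HE, nE, IsSmall]

theorem reads_keyE : keyE.Reads IsSmall := by
  simp [keyE, rowE, colE, counter, mE, dE, IsSmall]

theorem reads_valueE : valueE.Reads IsSmall := by
  simp [valueE, rowE, colE, counter, mE, dE, IsSmall]

theorem reads_tokensE : tokensE.Reads IsSmall := by simp [tokensE, NE, mE, IsSmall]

theorem reads_weightsE : weightsE.Reads IsSmall := by simp [weightsE, LE, HE, mE, IsSmall]

theorem ratArray_rowMajor {a b : ℕ} (F : ℕ → ℕ → ℕ) :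
    ratArray (rowMajor fun (i : Fin a) (j : Fin b) => (F i j : ℚ)) =
      codeArray (fun t => F (t / b) (t % b)) (a * b) := by
  rw [← ratArray_natCast]
  rfl

theorem ratArray_flattenWeights {m L H : ℕ} (F : ℕ → ℕ → ℕ → ℕ) :
    ratArray (flattenWeights fun (ℓ : Fin L) (h : Fin H) =>
        (Matrix.of fun (a b : Fin m) => (F (ℓ * H + h) a b : ℚ))) =
      codeArray (fun t => F (t / (m * m)) (t / m % m) (t % m)) (L * (H * (m * m))) := by
  rw [← ratArray_natCast]
  congr 1
  ext p
  simp only [flattenWeights, rowMajor, Fin.coe_divNat, Fin.coe_modNat, Matrix.of_apply,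
    Nat.mod_mul_left_div_self, Nat.mod_mul_left_mod]
  -- Layer and head recombine to the global head number.
  have (x K : ℕ) : x / (H * K) * H + x / K % H = x / K := by
    rw [mul_comm H, ← Nat.div_div_eq_div_mul, Nat.div_add_mod']
  rw [this]

/-- Write the input for a transformer. -/
def prepare : Prog :=
  .seq (.store (bank 0) (0 : Expr).addr NE) <| .seq (.store (bank 0) (1 : Expr).addr mE) <|
  .seq (.store (bank 0) (2 : Expr).addr LE) <| .seq (.store (bank 0) (3 : Expr).addr HE) <|
  .seq (fill 1 tokensE tokenE) <| .seq (fill 2 weightsE queryE) <|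
  .seq (fill 3 weightsE keyE) (fill 4 weightsE valueE)

def prepareWeight : ℕ :=
  ((0 : Expr).addr.weight + NE.weight + 1) + ((1 : Expr).addr.weight + mE.weight + 1) +
    ((2 : Expr).addr.weight + LE.weight + 1) + ((3 : Expr).addr.weight + HE.weight + 1) +
    fillWeight tokensE tokenE + fillWeight weightsE queryE +
    fillWeight weightsE keyE + fillWeight weightsE valueE

section Prepare

variable {π : Params} {inp : State} {β i t r : ℕ} {s : State}

theorem Work.prepare (h : Work π inp i t r (fun _ _ => 0) s) (hf : Fits π inp β) (hi : i < π.M)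
    (ht : t.size ≤ β) :
    Runs prepare s
      (prepareWeight * β * (π.N * π.m + π.L * (π.H * (π.m * π.m)) + 1))
      (Work π inp i (π.L * (π.H * (π.m * π.m))) r
        (transformerInput (weights π inp i) (tokens π inp i))) := by
  have hN : NE.Reads IsSmall := by simp [NE, IsSmall]
  have hm : mE.Reads IsSmall := by simp [mE, IsSmall]
  have hL : LE.Reads IsSmall := by simp [LE, IsSmall]
  have hH : HE.Reads IsSmall := by simp [HE, IsSmall]
  refine ((h.store_bank hf hi ht 0 (x := 0) (y := NE) trivial hN).seq fun s₁ h₁ =>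
    (h₁.store_bank hf hi ht 0 (x := 1) (y := mE) trivial hm).seq fun s₂ h₂ =>
    (h₂.store_bank hf hi ht 0 (x := 2) (y := LE) trivial hL).seq fun s₃ h₃ =>
    (h₃.store_bank hf hi ht 0 (x := 3) (y := HE) trivial hH).seq fun s₄ h₄ =>
    (h₄.fill hf hi ht (a := 1) ?_ (b := π.N * π.m) reads_tokensE reads_tokenE hf.tokens_size ?_
      fun t s _ h => eval_tokenE h hf).seq fun s₅ h₅ =>
    (h₅.fill hf hi hf.tokens_size (a := 2) ?_ (b := π.L * (π.H * (π.m * π.m))) reads_weightsE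
      reads_queryE hf.weights_size ?_ fun t s _ h => eval_queryE h hf).seq fun s₆ h₆ =>
    (h₆.fill hf hi hf.weights_size (a := 3) ?_ (b := π.L * (π.H * (π.m * π.m))) reads_weightsE
      reads_keyE hf.weights_size ?_ fun t s _ h => eval_keyE h hf).seq fun s₇ h₇ =>
    (h₇.fill hf hi hf.weights_size (a := 4) ?_ (b := π.L * (π.H * (π.m * π.m))) reads_weightsE
      reads_valueE hf.weights_size ?_ fun t s _ h => eval_valueE h hf).mono le_rfl
      fun s₈ h₈ => ?_).mono_time ?_
  · ext x; simp [State.write]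
  · intro t s h; simp [tokensE, NE, mE, h.N_eq, h.m_eq]
  · ext x; simp [State.write]
  · intro t s h; simp [weightsE, LE, HE, mE, h.L_eq, h.H_eq, h.m_eq]
  · ext x; simp [State.write]
  · intro t s h; simp [weightsE, LE, HE, mE, h.L_eq, h.H_eq, h.m_eq]
  · ext x; simp [State.write]
  · intro t s h; simp [weightsE, LE, HE, mE, h.L_eq, h.H_eq, h.m_eq]
  · convert h₈ using 1
    have e₁ : NE.eval s = π.N := h.mem.N_eq
    have e₂ : mE.eval s₁ = π.m := h₁.mem.m_eq
    have e₃ : LE.eval s₂ = π.L := h₂.mem.L_eq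
    have e₄ : HE.eval s₃ = π.H := h₃.mem.H_eq
    rw [e₁, e₂, e₃, e₄]
    ext a x
    rcases a with _ | _ | _ | _ | _ | a
    · have : x = 0 ∨ x = 1 ∨ x = 2 ∨ x = 3 ∨ 4 ≤ x := by omega
      rcases this with rfl | rfl | rfl | rfl | hx
      · simp [transformerInput, State.write, natArray]
      · simp [transformerInput, State.write, natArray]
      · simp [transformerInput, State.write, natArray]
      · simp [transformerInput, State.write, natArray]
      · have : ¬ x < 4 := by omega
        have h₀ : x ≠ 0 ∧ x ≠ 1 ∧ x ≠ 2 ∧ x ≠ 3 := by omega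
        simp [transformerInput, State.write, natArray, this, h₀]
    · simp only [transformerInput, tokens, orthogonalityTokens, Matrix.of_apply, zero_add]
      rw [ratArray_rowMajor]
      simp
    · simp only [transformerInput, weights, orthogonalityWeights, zero_add, Nat.reduceAdd]
      rw [ratArray_flattenWeights (fun h a b => queryEntry π.N π.d (headVec π inp i h) a b)]
      simp
    · simp only [transformerInput, weights, orthogonalityWeights, zero_add, Nat.reduceAdd]
      rw [ratArray_flattenWeights (fun h a b => keyEntry π.d a b)]
      simp
    · simp only [transformerInput, weights, orthogonalityWeights, zero_add, Nat.reduceAdd]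
      rw [ratArray_flattenWeights (fun h a b => valueEntry π.d a b)]
      simp
    · simp [transformerInput, State.write]
  · rw [prepareWeight]
    generalize π.N * π.m = p
    generalize π.L * (π.H * (π.m * π.m)) = q
    have key : ∀ x y z : ℕ, y + 1 ≤ z → x * β * (y + 1) ≤ x * β * z :=
      fun x y z h => Nat.mul_le_mul_left _ h
    have key' : ∀ x : ℕ, x * β ≤ x * β * (p + q + 1) :=
      fun x => Nat.le_mul_of_pos_right _ (by omega)
    simp only [add_mul _ _ β, add_mul _ _ (p + q + 1)]
    have k₁ := key (fillWeight tokensE tokenE) p (p + q + 1) (by omega)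
    have k₂ := key (fillWeight weightsE queryE) q (p + q + 1) (by omega)
    have k₃ := key (fillWeight weightsE keyE) q (p + q + 1) (by omega)
    have k₄ := key (fillWeight weightsE valueE) q (p + q + 1) (by omega)
    have k₅ := key' (0 : Expr).addr.weight
    have k₆ := key' (1 : Expr).addr.weight
    have k₇ := key' (2 : Expr).addr.weight
    have k₈ := key' (3 : Expr).addr.weight
    have k₉ := key' NE.weight
    have l₁ := key' mE.weight
    have l₂ := key' LE.weight
    have l₃ := key' HE.weight
    have l₄ := key' 1
    linarith

end Prepare

/-! ### Reading the output of a transformer -/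

/-- The address of a part of the output entry that belongs to the token given by the counter. -/
def outAddrE (q : Expr) : Expr := 3 * (counter * mE + (2 * dE + 1)) + q

/-- The address of part `q` of the output entry of token `j`. -/
def Params.outAddr (π : Params) (q j : ℕ) : ℕ := 3 * (j * π.m + (2 * π.d + 1)) + q

/-- A test whether the output entry of the token given by the counter is greater than `1 / 4`. -/
def testE : Expr :=
  4 * .load (bank 5) (outAddrE 0).addr -
    (4 * .load (bank 5) (outAddrE 1).addr + .load (bank 5) (outAddrE 2).addr)

/-- The output entry of token `j` is greater than `1 / 4`. -/
def Accepts (π : Params) (v : State) (j : ℕ) : Prop :=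
  4 * v 5 (π.outAddr 1 j) + v 5 (π.outAddr 2 j) < 4 * v 5 (π.outAddr 0 j)

/-- Set the answer to `1` if some output entry is large. -/
def scan : Prog :=
  .seq (.store 7 0 1) <| .loop (NE - counter) <|
    .seq (.ite testE (.store 5 0 1) .skip) (.store 7 0 (counter + 1))

def scanWeight : ℕ :=
  (NE - counter).weight + (outAddrE 0).addr.weight + (outAddrE 1).addr.weight +
    (outAddrE 2).addr.weight + (counter + 1).weight + 50

section Scan

variable {π : Params} {inp : State} {β i t r : ℕ} {s v : State}

/-- Needed so that the lengths of the output cells of different tokens can be summed and charged to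
the running time. -/
theorem Params.outAddr_injective (hm : 0 < π.m) (q : ℕ) : (π.outAddr q).Injective := by
  intro a b h
  have : a * π.m = b * π.m := by simp only [Params.outAddr] at h; omega
  exact Nat.eq_of_mul_eq_mul_right hm this

theorem Work.eval_load_outAddrE (h : Work π inp i t r v s) (hf : Fits π inp β) {e : Expr} {q : ℕ}
    (he : e.eval s = q) :
    (Expr.load (bank 5) (outAddrE e).addr).eval s = v 5 (π.outAddr q t) := by
  rw [← h.holds.cell]
  simp [outAddrE, counter, mE, dE, Params.outAddr, h.mem.t_eq, h.mem.m_eq, h.mem.d_eq hf,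
    h.mem.M_eq, h.mem.i_eq, he]

theorem Work.eval_testE (h : Work π inp i t r v s) (hf : Fits π inp β) :
    testE.eval s ≠ 0 ↔ Accepts π v t := by
  simp only [testE, Expr.eval_sub, Expr.eval_add, Expr.eval_mul, Expr.eval_ofNat,
    h.eval_load_outAddrE hf (e := 0) (q := 0) rfl,
    h.eval_load_outAddrE hf (e := 1) (q := 1) rfl,
    h.eval_load_outAddrE hf (e := 2) (q := 2) rfl, Accepts]
  omega

/-- Addresses have `O(β)` bits, but the output cells can hold numbers of any length, so their sizes
stay explicit in the bound. -/
theorem Work.cost_testE_le (h : Work π inp i t r v s) (hf : Fits π inp β) (hi : i < π.M)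
    (ht : t.size ≤ β) :
    testE.cost s ≤ ((outAddrE 0).addr.weight + (outAddrE 1).addr.weight +
      (outAddrE 2).addr.weight + 28) * β + 3 * ((v 5 (π.outAddr 0 t)).size +
        (v 5 (π.outAddr 1 t)).size + (v 5 (π.outAddr 2 t)).size) := by
  have r₀ : ∀ q : Expr, q.Reads IsSmall → (outAddrE q).addr.Reads IsSmall := by
    intro q hq
    simp [outAddrE, counter, mE, dE, IsSmall, hq]
  have c₀ := h.mem.cost_le hf hi.le ht (r₀ 0 trivial)
  have c₁ := h.mem.cost_le hf hi.le ht (r₀ 1 trivial)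
  have c₂ := h.mem.cost_le hf hi.le ht (r₀ 2 trivial)
  have e₀ := h.eval_load_outAddrE hf (e := 0) (q := 0) rfl
  have e₁ := h.eval_load_outAddrE hf (e := 1) (q := 1) rfl
  have e₂ := h.eval_load_outAddrE hf (e := 2) (q := 2) rfl
  rw [Expr.eval_load] at e₀ e₁ e₂
  simp only [testE, Expr.cost_sub, Expr.cost_add, Expr.cost_mul, Expr.cost_load, Expr.cost_ofNat,
    Expr.eval_mul, Expr.eval_add, Expr.eval_load, Expr.eval_ofNat, e₀, e₁, e₂]
  have h4 : Nat.size 4 = 3 := by decide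
  have b₁ := size_mul_le 4 (v 5 (π.outAddr 0 t))
  have b₂ := size_mul_le 4 (v 5 (π.outAddr 1 t))
  have b₃ := size_add_le (4 * v 5 (π.outAddr 1 t)) (v 5 (π.outAddr 2 t))
  have b₄ := Nat.size_le_size (Nat.sub_le (4 * v 5 (π.outAddr 0 t))
    (4 * v 5 (π.outAddr 1 t) + v 5 (π.outAddr 2 t)))
  have := hf.pos
  simp only [add_mul]
  omega

/-- The answer is never reset, so it accumulates the disjunction over all transformers. The sum of
cell sizes is kept because only the total length, not each single one, is well controlled by the
running time. -/
theorem Work.scan (h : Work π inp i t r v s) (hf : Fits π inp β) (hi : i < π.M)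
    (ht : t.size ≤ β) (hN : 1 ≤ π.N) :
    Runs scan s (scanWeight * β * (π.N + 1) + 3 * ∑ j ∈ Finset.Ico 1 π.N,
        ((v 5 (π.outAddr 0 j)).size + (v 5 (π.outAddr 1 j)).size + (v 5 (π.outAddr 2 j)).size))
      fun s' => ∃ r', Work π inp i π.N r' v s' ∧
        (r' ≠ 0 ↔ r ≠ 0 ∨ ∃ j, 1 ≤ j ∧ j < π.N ∧ Accepts π v j) := by
  have hc := reads_counter
  have hNE : NE.Reads IsSmall := by simp [NE, IsSmall]
  have e₀ (s : State) : (0 : Expr).cost s = 1 := rfl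
  have e₁ (s : State) : (1 : Expr).cost s = 2 := rfl
  have w₁ : (1 : Expr).weight = 2 := rfl
  refine ((h.store_counter hf hi ht (y := 1) trivial).seq fun s h => Runs.loop
    (I := fun t s => ∃ r', Work π inp i t r' v s ∧
        (r' ≠ 0 ↔ r ≠ 0 ∨ ∃ j, 1 ≤ j ∧ j < t ∧ Accepts π v j))
    (κ := ((NE - counter).weight + 1) * β)
    (c := fun j => (((outAddrE 0).addr.weight + (outAddrE 1).addr.weight +
      (outAddrE 2).addr.weight + 28) * β + 3 * ((v 5 (π.outAddr 0 j)).size +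
        (v 5 (π.outAddr 1 j)).size + (v 5 (π.outAddr 2 j)).size) + 1 + 4) +
        ((counter + 1).weight + 2) * β) hN ?_ ?_ ?_).mono_time ?_
  · rintro t s h1t htN ⟨r', h, hr⟩
    have ht : t.size ≤ β := (Nat.size_le_size htN.le).trans hf.N_size
    refine ⟨?_, ?_, ?_⟩
    · simp only [NE, counter, Expr.eval_sub, Expr.eval_load, Expr.eval_ofNat, h.mem.t_eq,
        h.mem.N_eq]
      omega
    · have := h.mem.cost_le hf hi.le ht (e := NE - counter) ⟨hNE, hc⟩
      have := hf.pos
      rw [add_mul]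
      omega
    · have hcost := h.cost_testE_le hf hi ht
      refine ((Runs.ite (T := 4) (post := fun s' => ∃ r', Work π inp i t r' v s' ∧
        (r' ≠ 0 ↔ r ≠ 0 ∨ ∃ j, 1 ≤ j ∧ j < t + 1 ∧ Accepts π v j)) ?_ ?_).mono_time ?_).seq ?_
      · intro he
        rw [h.eval_testE hf] at he
        refine (Runs.store ?_).mono_time ?_
        · exact ⟨1, h.set_out 1,
            iff_of_true one_ne_zero (Or.inr ⟨t, h1t, Nat.lt_succ_self t, he⟩)⟩
        · rw [e₀, e₁]
      · intro he
        have he' : ¬ Accepts π v t := fun h' => (h.eval_testE hf).2 h' he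
        refine (Runs.skip ⟨r', h, hr.trans (or_congr Iff.rfl (exists_congr fun j => ?_))⟩).mono_time
          (by norm_num)
        refine and_congr_right fun _ => ⟨fun h => ⟨by omega, h.2⟩, fun h => ⟨?_, h.2⟩⟩
        rcases Nat.lt_succ_iff_lt_or_eq.1 h.1 with h' | rfl
        · exact h'
        · exact absurd h.2 he'
      · omega
      · rintro s₁ ⟨r₁, h₁, hr₁⟩
        refine (h₁.store_counter hf hi ht (y := counter + 1) ⟨hc, trivial⟩).mono le_rfl
          fun s₂ h₂ => ⟨r₁, ?_, hr₁⟩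
        have e : counter.eval s₁ = t := h₁.mem.t_eq
        simpa only [Expr.eval_add, Expr.eval_ofNat, e] using h₂
  · rintro s ⟨r', h, -⟩
    refine ⟨?_, ?_⟩
    · simp only [NE, counter, Expr.eval_sub, Expr.eval_load, Expr.eval_ofNat, h.mem.t_eq,
        h.mem.N_eq]
      omega
    · have := h.mem.cost_le hf hi.le hf.N_size (e := NE - counter) ⟨hNE, hc⟩
      have := hf.pos
      rw [add_mul]
      omega
  · refine ⟨r, h, ⟨Or.inl, fun h => h.resolve_right ?_⟩⟩
    rintro ⟨j, h₁, h₂, -⟩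
    exact absurd h₂ (not_lt.2 h₁)
  · rw [w₁, scanWeight]
    generalize (NE - counter).weight = w₁
    generalize (outAddrE 0).addr.weight = w₂
    generalize (outAddrE 1).addr.weight = w₃
    generalize (outAddrE 2).addr.weight = w₄
    generalize (counter + 1).weight = w₅
    have hβ := hf.pos
    obtain ⟨n, hn⟩ : ∃ n, π.N = n + 1 := ⟨π.N - 1, by omega⟩
    rw [Finset.mul_sum]
    simp only [Finset.sum_add_distrib, Finset.sum_const, Nat.card_Ico, smul_eq_mul]
    rw [hn, Nat.add_sub_cancel]
    generalize (∑ j ∈ Finset.Ico 1 (n + 1), 3 * ((v 5 (π.outAddr 0 j)).size +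
        (v 5 (π.outAddr 1 j)).size + (v 5 (π.outAddr 2 j)).size)) = S
    have e : (w₁ + w₂ + w₃ + w₄ + w₅ + 50) * β * (n + 1 + 1) + S =
        (2 + 2) * β + (n * ((w₁ + 1) * β) + (n * ((w₂ + w₃ + w₄ + 28) * β) + S + n * β + n * (4 * β) +
          n * ((w₅ + 2) * β)) + (w₁ + 1) * β) +
        (w₁ + 2 * (w₂ + w₃ + w₄ + w₅) + 95 + 14 * n) * β := by ring
    rw [e]
    have : n * 1 ≤ n * β := Nat.mul_le_mul_left _ hβ
    have : n * 4 ≤ n * (4 * β) := Nat.mul_le_mul_left _ (by omega)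
    omega

end Scan

/-! ### Processing all transformers -/

/-- Some token of transformer `i` belongs to an orthogonal triple. -/
def Found (π : Params) (inp : State) (i : ℕ) : Prop :=
  ∃ j, 1 ≤ j ∧ j < π.N ∧ InOrthogonalTriple π.N π.d (π.L * π.H) (headVec π inp i)
    (rowVec π inp i) (colVec π inp i) j

/-- Process the current transformer. -/
def process (P : Prog) : Prog :=
  .seq prepare <| .seq (P.relocate bank) <| .seq scan (.store 6 1 (indexE + 1))

def processAll (P : Prog) : Prog :=
  .loop (.load 6 0 - indexE) (process P)

/-- On each transformer, the program `P` halts after time `τ` with an output that tells which tokens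
belong to orthogonal triples. -/
def Succeeds (π : Params) (inp : State) (P : Prog) (τ : ℕ) : Prop :=
  ∀ i, Runs P (transformerInput (weights π inp i) (tokens π inp i)) τ fun v =>
    ∀ j, 1 ≤ j → j < π.N → (Accepts π v j ↔ InOrthogonalTriple π.N π.d (π.L * π.H)
      (headVec π inp i) (rowVec π inp i) (colVec π inp i) j)

def processWeight : ℕ := prepareWeight + scanWeight + (indexE + 1).weight + 50

section Loop

variable {π : Params} {inp : State} {β i t r τ : ℕ} {s : State} {P : Prog}

/-- Part `i` has not been touched by earlier runs, so the next simulation sees blank memory without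
any clearing. -/
theorem Fresh.work (h : Fresh π.M i s) (hs : Mem π inp i t r s) (hi : i < π.M) :
    Work π inp i t r (fun _ _ => 0) s := by
  refine ⟨hs, ⟨hs.M_eq, hs.i_eq, fun a x => h a _ ?_⟩, fun a x hx => h a x (by omega)⟩
  rw [Nat.mul_add_mod', Nat.mod_eq_of_lt hi]

theorem Mem.process (hs : Mem π inp i t r s) (hs' : Fresh π.M i s) (hf : Fits π inp β)
    (hi : i < π.M) (ht : t.size ≤ β) (hN : 1 ≤ π.N) (hm : 1 ≤ π.m) (hP : Succeeds π inp P τ) :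
    Runs (process P) s
      (processWeight * β * (π.N * π.m + π.L * (π.H * (π.m * π.m)) + τ + 1))
      fun s' => ∃ r', Mem π inp (i + 1) π.N r' s' ∧ Fresh π.M (i + 1) s' ∧
        (r' ≠ 0 ↔ r ≠ 0 ∨ Found π inp i) := by
  obtain ⟨v, t', h₁, ht', h₂⟩ := hP i
  have h6 : ∀ a, bank a ≠ 6 := fun a => bank_ne (by norm_num)
  refine (((hs'.work hs hi).prepare hf hi ht).seq fun s₁ w₁ =>
    ((h₁.relocate bank_injective h6 hi s₁ w₁.holds).mono le_rfl
      fun s₂ h => w₁.of_holds h.1 h.2).seq fun s₂ w₂ =>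
    (w₂.scan hf hi hf.weights_size hN).seq (T₂ := ((indexE + 1).weight + 3) * β)
      fun s₃ ⟨r', w₃, hr'⟩ => ?_).mono_time ?_
  · have hri : (indexE + 1).Reads IsSmall := by simp [indexE, IsSmall]
    refine (Runs.store ?_).mono_time ?_
    · have e₁ : (1 : Expr).eval s₃ = 1 := rfl
      have e₂ : (indexE + 1).eval s₃ = i + 1 := by
        simp [indexE, w₃.mem.i_eq]
      rw [e₁, e₂]
      refine ⟨r', w₃.mem.set_index _, ?_, hr'.trans (or_congr Iff.rfl ?_)⟩
      · intro a x hx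
        rw [← w₃.fresh a x hx]
        simp [State.write, h6]
      · refine exists_congr fun j => ?_
        constructor
        · rintro ⟨h₃, h₄, h₅⟩
          exact ⟨h₃, h₄, (h₂ j h₃ h₄).1 h₅⟩
        · rintro ⟨h₃, h₄, h₅⟩
          exact ⟨h₃, h₄, (h₂ j h₃ h₄).2 h₅⟩
    · have := w₃.mem.cost_le hf hi.le hf.N_size hri
      have e : (1 : Expr).cost s₃ = 2 := rfl
      have := hf.pos
      rw [add_mul]
      omega
  -- The output array starts blank, so after time at most `τ` its cells have total length at most
  -- `τ`.
  · have key : ∀ q, ∑ j ∈ Finset.Ico 1 π.N, (v 5 (π.outAddr q j)).size ≤ τ := by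
      intro q
      refine (h₁.sum_size_le 5 (Finset.Ico 1 π.N) (Params.outAddr_injective hm q)).trans ?_
      simpa [transformerInput] using ht'
    have k₀ := key 0
    have k₁ := key 1
    have k₂ := key 2
    simp only [Finset.sum_add_distrib]
    have hNm : π.N ≤ π.N * π.m := Nat.le_mul_of_pos_right _ hm
    have hβ := hf.pos
    have k₃ : (4 * π.M.size + 9) * t' ≤ 13 * β * τ :=
      Nat.mul_le_mul (by have := hf.M_size; omega) ht'
    have k₄ : scanWeight * β * (π.N + 1) ≤ scanWeight * β * (π.N * π.m + 1) :=
      Nat.mul_le_mul_left _ (by omega)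
    have k₅ : 1 * τ ≤ β * τ := Nat.mul_le_mul_right _ hβ
    rw [processWeight]
    generalize π.N * π.m = p at *
    generalize π.L * (π.H * (π.m * π.m)) = q at *
    generalize prepareWeight = w₁ at *
    generalize scanWeight = w₂ at *
    generalize (indexE + 1).weight = w₃ at *
    have e : (w₁ + w₂ + w₃ + 50) * β * (p + q + τ + 1) =
      w₁ * β * (p + q + 1) + (w₂ * β * (p + 1) + 13 * β * τ + 9 * (β * τ) + (w₃ + 3) * β) +
      ((w₁ + w₂ + w₃ + 28) * (β * τ) + w₂ * β * q + w₃ * β * (p + q) +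
        50 * β * (p + q) + 47 * β) := by ring
    rw [e]
    omega

theorem Mem.processAll (hs : Mem π inp 0 0 0 s) (hs' : Fresh π.M 0 s) (hf : Fits π inp β)
    (hN : 1 ≤ π.N) (hm : 1 ≤ π.m) (hP : Succeeds π inp P τ) :
    Runs (processAll P) s
      ((processWeight + 11) * β * (π.N * π.m + π.L * (π.H * (π.m * π.m)) + τ + 1) * (π.M + 1))
      fun s' => (s' outArray 0 ≠ 0 ↔ ∃ i < π.M, Found π inp i) := by
  have hβ := hf.pos
  have hcond : ∀ i t r s, i ≤ π.M → Mem π inp i t r s →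
      (Expr.load 6 0 - indexE).eval s = π.M - i ∧
        (Expr.load 6 0 - indexE).cost s + 1 ≤ 10 * β := by
    intro i t r s hi h
    have h₁ : (Expr.load 6 0).eval s = π.M := h.M_eq
    have h₂ : indexE.eval s = i := h.i_eq
    refine ⟨by rw [Expr.eval_sub, h₁, h₂], ?_⟩
    simp only [indexE, Expr.cost_sub, Expr.cost_load, Expr.cost_ofNat, Expr.eval_load,
      Expr.eval_ofNat, h.M_eq, h.i_eq]
    have := hf.M_size
    have := Nat.size_le_size hi
    have := Nat.size_le_size (Nat.sub_le π.M i)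
    have : Nat.size 1 = 1 := by simp
    have : Nat.size 0 = 0 := by simp
    omega
  refine (Runs.loop
    -- The counter value left behind by one round is irrelevant to the next; only its length
    -- matters.
    (I := fun i s => ∃ t r, Mem π inp i t r s ∧ t.size ≤ β ∧ Fresh π.M i s ∧
      (r ≠ 0 ↔ ∃ i' < i, Found π inp i'))
    (κ := 10 * β)
    (c := fun _ => processWeight * β * (π.N * π.m + π.L * (π.H * (π.m * π.m)) + τ + 1))
    (Nat.zero_le π.M) ?_ ?_ ?_).mono ?_ ?_
  · rintro i s - hi ⟨t, r, h, ht, hF, hr⟩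
    obtain ⟨h₁, h₂⟩ := hcond i t r s hi.le h
    refine ⟨by omega, h₂, (h.process hF hf hi ht hN hm hP).mono le_rfl ?_⟩
    rintro s' ⟨r', h₃, h₄, h₅⟩
    refine ⟨π.N, r', h₃, hf.N_size, h₄, h₅.trans ?_⟩
    rw [hr]
    constructor
    · rintro (⟨i', h₆, h₇⟩ | h)
      · exact ⟨i', by omega, h₇⟩
      · exact ⟨i, by omega, h⟩
    · rintro ⟨i', h₆, h₇⟩
      rcases Nat.lt_succ_iff_lt_or_eq.1 h₆ with h | rfl
      · exact Or.inl ⟨i', h, h₇⟩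
      · exact Or.inr h₇
  · rintro s ⟨t, r, h, -⟩
    obtain ⟨h₁, h₂⟩ := hcond π.M t r s le_rfl h
    exact ⟨by omega, h₂⟩
  · exact ⟨0, 0, hs, by simp, hs', by simp⟩
  · simp only [Finset.sum_const, Nat.card_Ico, smul_eq_mul, Nat.sub_zero]
    generalize π.N * π.m + π.L * (π.H * (π.m * π.m)) + τ = p
    generalize processWeight = w
    generalize π.M = M
    have e : (w + 11) * β * (p + 1) * (M + 1) = M * (10 * β + w * β * (p + 1)) + 10 * β +
        (w * β * (p + 1) + 11 * β * p * (M + 1) + β * M + β) := by ring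
    rw [e]
    exact Nat.le_add_right _ _
  · rintro s' ⟨t, r, h, -, -, hr⟩
    have : s' outArray 0 = r := by
      have := congrFun h.out 0
      simpa [outArray] using this
    rw [this, hr]

end Loop

/-! ### Every triple of vectors occurs in some transformer -/

section Coverage

variable {π : Params} {inp : State}

/-- The index `i` is a mixed-radix number whose digits are the chunk of `x` and the blocks of `y`
and `z`; the remainders give the head and the two tokens. -/
theorem exists_found_iff (hn : 0 < π.n) (hL : 1 ≤ π.L) (hH : 1 ≤ π.H) (hN : 2 ≤ π.N) :
    (∃ i < π.M, Found π inp i) ↔ ∃ x < π.n, ∃ y < π.n, ∃ z < π.n, ∀ c < π.d,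
      inp 1 (x * π.d + c) * inp 2 (y * π.d + c) * inp 3 (z * π.d + c) = 0 := by
  constructor
  -- Chunks and blocks that overrun the end wrap around modulo `n`. Vectors are then repeated, but
  -- every triple found is still one of the instance.
  · rintro ⟨i, -, j, -, -, h, -, k, -, -, hk⟩
    exact ⟨_, Nat.mod_lt _ hn, _, Nat.mod_lt _ hn, _, Nat.mod_lt _ hn, hk⟩
  · rintro ⟨x, hx, y, hy, z, hz, h⟩
    have hLH : 0 < π.L * π.H := Nat.mul_pos hL hH
    have hN' : 0 < π.N - 1 := by omega
    have hq : y / (π.N - 1) < π.B := Nat.lt_succ_of_le (Nat.div_le_div_right hy.le)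
    have hr : z / (π.N - 1) < π.B := Nat.lt_succ_of_le (Nat.div_le_div_right hz.le)
    have hp : x / (π.L * π.H) < π.n / (π.L * π.H) + 1 :=
      Nat.lt_succ_of_le (Nat.div_le_div_right hx.le)
    have hB : 0 < π.B := Nat.succ_pos _
    set i := x / (π.L * π.H) * (π.B * π.B) + (y / (π.N - 1) * π.B + z / (π.N - 1)) with hi
    have hlt : y / (π.N - 1) * π.B + z / (π.N - 1) < π.B * π.B := by nlinarith
    have e₁ : i / (π.B * π.B) = x / (π.L * π.H) := by
      rw [hi, Nat.mul_comm, Nat.mul_add_div (by positivity), Nat.div_eq_of_lt hlt, add_zero]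
    have e₂ : i / π.B = x / (π.L * π.H) * π.B + y / (π.N - 1) := by
      have : i = π.B * (x / (π.L * π.H) * π.B + y / (π.N - 1)) + z / (π.N - 1) := by
        rw [hi]; ring
      rw [this, Nat.mul_add_div hB, Nat.div_eq_of_lt hr, add_zero]
    have e₃ : i / π.B % π.B = y / (π.N - 1) := by
      rw [e₂, Nat.mul_add_mod', Nat.mod_eq_of_lt hq]
    have e₄ : i % π.B = z / (π.N - 1) := by
      have : i = (x / (π.L * π.H) * π.B + y / (π.N - 1)) * π.B + z / (π.N - 1) := by
        rw [hi]; ring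
      rw [this, Nat.mul_add_mod', Nat.mod_eq_of_lt hr]
    have hyr := Nat.mod_lt y hN'
    have hzr := Nat.mod_lt z hN'
    -- The shift by one skips the reserved token `0`.
    refine ⟨i, ?_, y % (π.N - 1) + 1, by omega, by omega, x % (π.L * π.H), Nat.mod_lt _ hLH,
      z % (π.N - 1) + 1, by omega, by omega, fun c hc => ?_⟩
    · rw [Params.M]
      calc i < x / (π.L * π.H) * (π.B * π.B) + π.B * π.B := by omega
        _ = (x / (π.L * π.H) + 1) * (π.B * π.B) := by ring
        _ ≤ _ := Nat.mul_le_mul_right _ hp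
    · rw [headVec, rowVec, colVec, e₁, e₃, e₄, Nat.div_add_mod', Nat.add_sub_cancel,
        Nat.add_sub_cancel, Nat.div_add_mod', Nat.div_add_mod', Nat.mod_eq_of_lt hx,
        Nat.mod_eq_of_lt hy, Nat.mod_eq_of_lt hz]
      exact h c hc

theorem ovInput_cell {n d : ℕ} (F : Fin n → Fin d → Bool) {x c : ℕ} (hx : x < n) (hc : c < d) :
    natArray (rowMajor fun i j => (F i j).toNat) (x * d + c) = (F ⟨x, hx⟩ ⟨c, hc⟩).toNat := by
  have h : x * d + c < n * d := by
    calc x * d + c < x * d + d := by omega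
      _ = (x + 1) * d := by ring
      _ ≤ n * d := Nat.mul_le_mul_right _ hx
  have h₁ : (x * d + c) / d = x := by
    rw [mul_comm, Nat.mul_add_div (by omega), Nat.div_eq_of_lt hc, add_zero]
  have h₂ : (x * d + c) % d = c := by
    rw [Nat.mul_add_mod', Nat.mod_eq_of_lt hc]
  simp only [natArray, h, dif_pos, rowMajor]
  congr 3 <;> ext <;> simp [h₁, h₂]

theorem exists_orthogonalTriple_iff {n d : ℕ} (A B C : Fin n → Fin d → Bool) :
    (∃ x < n, ∃ y < n, ∃ z < n, ∀ c < d, ovInput A B C 1 (x * d + c) *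
      ovInput A B C 2 (y * d + c) * ovInput A B C 3 (z * d + c) = 0) ↔
      ∃ i j k, OrthogonalTriple (A i) (B j) (C k) := by
  have key : ∀ x y z (hx : x < n) (hy : y < n) (hz : z < n),
      (∀ c < d, ovInput A B C 1 (x * d + c) * ovInput A B C 2 (y * d + c) *
        ovInput A B C 3 (z * d + c) = 0) ↔
      OrthogonalTriple (A ⟨x, hx⟩) (B ⟨y, hy⟩) (C ⟨z, hz⟩) := by
    intro x y z hx hy hz
    have : ∀ c (hc : c < d), (ovInput A B C 1 (x * d + c) * ovInput A B C 2 (y * d + c) *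
        ovInput A B C 3 (z * d + c) = 0 ↔ A ⟨x, hx⟩ ⟨c, hc⟩ = false ∨ B ⟨y, hy⟩ ⟨c, hc⟩ = false ∨
          C ⟨z, hz⟩ ⟨c, hc⟩ = false) := by
      intro c hc
      simp only [ovInput, ovInput_cell _ hx hc, ovInput_cell _ hy hc, ovInput_cell _ hz hc]
      cases A ⟨x, hx⟩ ⟨c, hc⟩ <;> cases B ⟨y, hy⟩ ⟨c, hc⟩ <;> cases C ⟨z, hz⟩ ⟨c, hc⟩ <;> simp
    exact ⟨fun h c => (this c c.2).1 (h c c.2), fun h c hc => (this c hc).2 (h ⟨c, hc⟩)⟩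
  constructor
  · rintro ⟨x, hx, y, hy, z, hz, h⟩
    exact ⟨_, _, _, (key x y z hx hy hz).1 h⟩
  · rintro ⟨i, j, k, h⟩
    exact ⟨i, i.2, j, j.2, k, k.2, (key i j k i.2 j.2 k.2).2 h⟩

end Coverage

/-! ### Algorithms that compute transformers succeed -/

theorem ratBounded_natCast {B x : ℕ} (hx : x ≤ B) (hB : 1 ≤ B) : RatBounded B (x : ℚ) := by
  simpa [RatBounded] using ⟨hx, hB⟩

section Succeeds

variable {π : Params} {inp : State} {b τ : ℕ} {P : Prog}

/-- The amplified query entries reach `N`, which is where `1 ≤ b` enters. -/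
theorem weights_bounded (hbit : ∀ a x, a = 1 ∨ a = 2 → inp a x ≤ 1) (hN : 1 ≤ π.N) (hb : 1 ≤ b)
    (i : ℕ) : (weights π inp i).Bounded (π.N ^ b) := by
  have h₁ : 1 ≤ π.N ^ b := Nat.one_le_pow _ _ hN
  have h₂ : π.N ≤ π.N ^ b := Nat.le_self_pow (by omega) _
  intro ℓ h j k
  refine ⟨ratBounded_natCast ?_ h₁, ratBounded_natCast ?_ h₁, ratBounded_natCast ?_ h₁⟩
  · rw [queryEntry]
    split_ifs
    · exact ((Nat.mul_le_mul_left _ (hbit 1 _ (Or.inl rfl))).trans (mul_one _).le).trans h₂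
    · omega
  · rw [keyEntry]
    split_ifs <;> omega
  · rw [valueEntry]
    split_ifs <;> omega

theorem tokens_bounded (hbit : ∀ a x, a = 1 ∨ a = 2 → inp a x ≤ 1) (hN : 1 ≤ π.N)
    (i : ℕ) (j : Fin π.N) (c : Fin π.m) : RatBounded (π.N ^ b) (tokens π inp i j c) := by
  have h₁ : 1 ≤ π.N ^ b := Nat.one_le_pow _ _ hN
  refine ratBounded_natCast (le_trans ?_ h₁) h₁
  rw [tokenEntry]
  split_ifs
  · exact hbit 2 _ (Or.inr rfl)
  all_goals omega

/-- A program that computes transformers with the given parameters up to a small error finds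
orthogonal triples. -/
theorem succeeds_of_computes (hbit : ∀ a x, a = 1 ∨ a = 2 → inp a x ≤ 1) (hN : 2 ≤ π.N)
    (hb : 1 ≤ b) (hm : 2 * π.d + 2 ≤ π.m)
    (hsmall : (π.L : ℝ) * π.H * (π.N * Real.exp (-π.N)) ≤ 1 / 10)
    (hP : ∀ (W : Weights π.m π.L π.H) (X : Matrix (Fin π.N) (Fin π.m) ℚ),
      W.Bounded (π.N ^ b) → (∀ i j, RatBounded (π.N ^ b) (X i j)) →
        Runs P (transformerInput W X) τ (OutputsApprox
          (W.transformer.eval (X.map (fun r : ℚ => (r : ℝ)))) (1 / (10 * (π.N : ℝ))))) :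
    Succeeds π inp P τ := by
  intro i
  refine (hP (weights π inp i) (tokens π inp i) (weights_bounded hbit (by omega) hb i)
    (tokens_bounded hbit (by omega) i)).mono le_rfl fun v hv j hj hjN => ?_
  obtain ⟨h₁, h₂⟩ := hv ⟨j, hjN⟩ ⟨2 * π.d + 1, by omega⟩
  set Y := (weights π inp i).transformer.eval
    ((tokens π inp i).map (fun r : ℚ => (r : ℝ))) ⟨j, hjN⟩ ⟨2 * π.d + 1, by omega⟩ with hY
  -- With this error, outputs are at least `9/20` or at most `3/20`, on opposite sides of the
  -- threshold `1/4`.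
  have hδ : (1 : ℝ) / (10 * π.N) ≤ 1 / 20 := by
    have : (2 : ℝ) ≤ π.N := by exact_mod_cast hN
    apply one_div_le_one_div_of_le <;> linarith
  have h₃ := abs_le.1 (h₂.trans hδ)
  have a₀ : π.outAddr 0 j = 3 * (j * π.m + (2 * π.d + 1)) := rfl
  have a₁ : π.outAddr 1 j = 3 * (j * π.m + (2 * π.d + 1)) + 1 := rfl
  have a₂ : π.outAddr 2 j = 3 * (j * π.m + (2 * π.d + 1)) + 2 := rfl
  have key : Accepts π v j ↔ (1 : ℝ) / 4 < ((v outArray (3 * (j * π.m + (2 * π.d + 1))) : ℝ) -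
      (v outArray (3 * (j * π.m + (2 * π.d + 1)) + 1) : ℝ)) /
      (v outArray (3 * (j * π.m + (2 * π.d + 1)) + 2) : ℝ) := by
    have hpos : (0 : ℝ) < (v outArray (3 * (j * π.m + (2 * π.d + 1)) + 2) : ℝ) := by
      exact_mod_cast Nat.pos_of_ne_zero h₁
    rw [lt_div_iff₀ hpos, Accepts, a₀, a₁, a₂, ← Nat.cast_lt (α := ℝ)]
    push_cast
    constructor <;> intro h <;> simp only [outArray] at * <;> linarith
  rw [key]
  constructor
  · intro h
    by_contra hno
    have := orthogonality_eval_of_no_triple (u := headVec π inp i) (v := rowVec π inp i)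
      (w := colVec π inp i) hm ⟨j, hjN⟩ ⟨2 * π.d + 1, by omega⟩ rfl hno
    have : Y ≤ 1 / 10 := this.trans hsmall
    linarith [h₃.1, h₃.2]
  · intro h
    have : 1 / 2 ≤ Y := orthogonality_eval_of_triple (u := headVec π inp i)
      (v := rowVec π inp i) (w := colVec π inp i) hm ⟨j, hjN⟩ ⟨2 * π.d + 1, by omega⟩ rfl h
    linarith [h₃.1, h₃.2]

end Succeeds

/-! ### Computing the parameters -/

/-- The array that holds the memory of array `a` for the algorithm that computes the parameters. -/
def paramBank (a : ℕ) : ℕ := 2 * a + 8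

theorem paramBank_injective : paramBank.Injective := fun a b h => by simpa [paramBank] using h

/-- The input of the algorithm that computes the parameters. -/
def paramInput (N : ℕ) : State := fun a => if a = 0 then natArray ![N] else fun _ => 0

/-- Outside of array `6`, which is `ρ`, the arrays in `U` are as in the input. -/
structure Pre (U : ℕ → Prop) (inp : State) (ρ : ℕ → ℕ) (s : State) : Prop where
  reg : s 6 = ρ
  eq : ∀ a, a ≠ 6 → U a → s a = inp a

/-- The arrays that are read when the parameters are computed. -/
def IsParam (a : ℕ) : Prop := a = 0 ∨ a = 6

/-- Set the register that is given by a numeral. -/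
def setReg (x : ℕ) (y : Expr) : Prog := .store 6 (.lit x) y

/-- An output of the algorithm that computes the parameters. -/
def paramE (x : Expr) : Expr := .load (paramBank 5) x.addr

/-- Set `N` to the `e`-th root of `n`. -/
def root (e : ℕ) : Prog :=
  .seq (setReg 2 1) (.loop (nE + 1 - (NE + 1).pow e) (setReg 2 (NE + 1)))

/-- Compute all parameters and store them in the registers. -/
def setup (e : ℕ) (P : Prog) : Prog :=
  .seq (root e) <| .seq (setReg 0 1) <| .seq (.store (paramBank 0) (0 : Expr).addr NE) <|
  .seq (P.relocate paramBank) <|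
  .seq (setReg 3 (paramE 0)) <| .seq (setReg 4 (paramE 1)) <| .seq (setReg 5 (paramE 2)) <|
  .seq (setReg 6 (nE / (NE - 1) + 1)) (setReg 0 ((nE / (LE * HE) + 1) * (BE * BE)))

def setupWeight (e : ℕ) : ℕ :=
  (nE + 1 - (NE + 1).pow e).weight + (NE + 1).weight + NE.weight +
    (nE / (NE - 1) + 1).weight + ((nE / (LE * HE) + 1) * (BE * BE)).weight + 300

section Setup

variable {U : ℕ → Prop} {inp s : State} {ρ : ℕ → ℕ} {β : ℕ}

theorem Pre.write (h : Pre U inp ρ s) (x y : ℕ) :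
    Pre U inp (Function.update ρ x y) (s.write 6 x y) := by
  refine ⟨?_, fun a ha hU => ?_⟩
  · ext z
    rw [← h.reg]
    by_cases hz : z = x <;> simp [State.write, hz]
  · rw [← h.eq a ha hU]
    ext z
    simp [State.write, ha]

theorem size_update_le (hρ : ∀ x, (ρ x).size ≤ β) {y : ℕ} (hy : y.size ≤ β) (x z : ℕ) :
    (Function.update ρ x y z).size ≤ β := by
  by_cases hz : z = x
  · subst hz; simpa using hy
  · simpa [hz] using hρ z

theorem Pre.cost_le (h : Pre U inp ρ s) (hU : U 0) (hβ : 1 ≤ β) (hinp : ∀ x, (inp 0 x).size ≤ β)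
    (hρ : ∀ x, (ρ x).size ≤ β) {y : Expr} (hy : y.Reads IsParam) : y.cost s ≤ y.weight * β := by
  refine Expr.cost_le hβ (S := IsParam) ?_ hy
  rintro a (rfl | rfl) x
  · rw [h.eq 0 (by norm_num) hU]; exact hinp x
  · rw [h.reg]; exact hρ x

theorem Pre.setReg (h : Pre U inp ρ s) (hU : U 0) (hβ : 1 ≤ β) (hinp : ∀ x, (inp 0 x).size ≤ β)
    (hρ : ∀ x, (ρ x).size ≤ β) {x : ℕ} (hx : x.size ≤ 3) {y : Expr} (hy : y.Reads IsParam) :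
    Runs (setReg x y) s ((y.weight + 5) * β) (Pre U inp (Function.update ρ x (y.eval s))) := by
  refine (Runs.store (h.write x (y.eval s))).mono_time ?_
  have := h.cost_le hU hβ hinp hρ hy
  simp only [Expr.cost]
  rw [add_mul]
  omega

/-- Registers `0` and `1` steer the simulation; the others may be filled while its memory is still
being read. -/
theorem _root_.RAM.Holds.write_reg {f : ℕ → ℕ} (hf : ∀ a, f a ≠ 6) {M i : ℕ} {v : State}
    (h : Holds f M i s v) {x : ℕ} (hx : 2 ≤ x) (y : ℕ) : Holds f M i (s.write 6 x y) v := by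
  refine ⟨?_, ?_, fun a z => ?_⟩
  · rw [← h.stride]; simp [State.write]; omega
  · rw [← h.part]; simp [State.write]; omega
  · rw [← h.cell]; simp [State.write, hf]

theorem Pre.set_param {v : State} (h : Pre U inp ρ s) (hv : Holds paramBank 1 0 s v) (hβ : 1 ≤ β)
    {x y : ℕ} (hx : x.size ≤ 3) (hx' : 2 ≤ x) {e : Expr} (he : e.eval s = y) (hy : y.size ≤ 2)
    (hc : e.cost s ≤ 5) (hvy : (v 5 y).size ≤ β) :
    Runs (Reduction.setReg x (paramE e)) s (40 * β)
      fun s' => Pre U inp (Function.update ρ x (v 5 y)) s' ∧ Holds paramBank 1 0 s' v := by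
  have e₁ : (paramE e).eval s = v 5 y := by
    rw [← hv.cell]
    simp [paramE, he, hv.stride, hv.part]
  refine (Runs.store ?_).mono_time ?_
  · rw [e₁]
    exact ⟨h.write _ _, hv.write_reg (fun a => by simp only [paramBank]; omega) hx' _⟩
  · have h₁ := Expr.cost_addr_le hv (by norm_num) (x := e)
    rw [he] at h₁
    have h₂ : (paramE e).cost s = e.addr.cost s + (1 + ((paramE e).eval s).size) := rfl
    rw [h₂, e₁]
    simp only [Expr.cost]
    have : Nat.size 1 = 1 := by simp
    omega

/-- Linear search is affordable: it takes `R` rounds, each with a fixed number of operations because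
the exponent is part of the program. Truncated subtraction makes the test succeed exactly while `(N
+ 1) ^ e ≤ n`. -/
theorem Pre.root (h : Pre U inp ρ s) (hU : U 0) (hβ : 1 ≤ β) (hinp : ∀ x, (inp 0 x).size ≤ β)
    (hρ : ∀ x, (ρ x).size ≤ β) {e R : ℕ} (hR : 1 ≤ R) (hRe : R ^ e ≤ inp 0 0)
    (hRe' : inp 0 0 < (R + 1) ^ e) (hRβ : R.size ≤ β) :
    Runs (root e) s
      (((nE + 1 - (NE + 1).pow e).weight + (NE + 1).weight + 20) * β * (R + 1))
      (Pre U inp (Function.update ρ 2 R)) := by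
  have hn : nE.Reads IsParam := by simp [nE, IsParam]
  have hN : NE.Reads IsParam := by simp [NE, IsParam]
  have hc : (nE + 1 - (NE + 1).pow e).Reads IsParam :=
    ⟨⟨hn, trivial⟩, Expr.Reads.pow (x := NE + 1) ⟨hN, trivial⟩ e⟩
  have w₁ : (1 : Expr).weight = 2 := rfl
  have hcond : ∀ t s, t ≤ R → Pre U inp (Function.update ρ 2 t) s →
      (nE + 1 - (NE + 1).pow e).eval s = inp 0 0 + 1 - (t + 1) ^ e ∧ (NE + 1).eval s = t + 1 ∧
      (∀ x, (Function.update ρ 2 t x).size ≤ β) := by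
    intro t s ht h
    refine ⟨?_, ?_, size_update_le hρ ((Nat.size_le_size ht).trans hRβ) 2⟩
    · simp [nE, NE, h.reg, h.eq 0 (by norm_num) hU]
    · simp [NE, h.reg]
  refine ((h.setReg hU hβ hinp hρ (x := 2) (y := 1) (by decide) trivial).seq fun s h => Runs.loop
    (I := fun t s => Pre U inp (Function.update ρ 2 t) s)
    (κ := ((nE + 1 - (NE + 1).pow e).weight + 1) * β)
    (c := fun _ => ((NE + 1).weight + 5) * β) hR ?_ ?_ h).mono_time ?_
  · intro t s _ ht h
    obtain ⟨h₁, h₂, h₃⟩ := hcond t s ht.le h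
    refine ⟨?_, ?_, ?_⟩
    · rw [h₁]
      have : (t + 1) ^ e ≤ R ^ e := Nat.pow_le_pow_left ht e
      omega
    · have := h.cost_le hU hβ hinp h₃ hc
      rw [add_mul]
      omega
    · refine (h.setReg hU hβ hinp h₃ (x := 2) (y := NE + 1) (by decide)
        ⟨hN, trivial⟩).mono le_rfl fun s' h' => ?_
      rwa [h₂, Function.update_idem] at h'
  · intro s h
    obtain ⟨h₁, h₂, h₃⟩ := hcond R s le_rfl h
    refine ⟨by omega, ?_⟩
    have := h.cost_le hU hβ hinp h₃ hc
    rw [add_mul]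
    omega
  · rw [w₁, Finset.sum_const, Nat.card_Ico, smul_eq_mul]
    generalize (nE + 1 - (NE + 1).pow e).weight = w₁
    generalize (NE + 1).weight = w₂
    obtain ⟨n, rfl⟩ : ∃ n, R = n + 1 := ⟨R - 1, by omega⟩
    rw [Nat.add_sub_cancel]
    have e : (w₁ + w₂ + 20) * β * (n + 1 + 1) =
        (2 + 5) * β + (n * ((w₁ + 1) * β + (w₂ + 5) * β) + (w₁ + 1) * β) +
        ((w₁ + 2 * w₂ + 32) * β + 14 * n * β) := by ring
    rw [e]
    exact Nat.le_add_right _ _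

variable {π : Params} {τ e : ℕ} {P : Prog}

/-- The parameters are computed correctly if all arrays except for `0`, …, `3` are `0` at the start. -/
theorem runs_setup (hf : Fits π inp β) (hinp : ∀ a, 4 ≤ a → inp a = fun _ => 0)
    (hN : 1 ≤ π.N) (hNe : π.N ^ e ≤ π.n) (hNe' : π.n < (π.N + 1) ^ e)
    (hP : Runs P (paramInput π.N) τ fun v =>
      v outArray 0 = π.m ∧ v outArray 1 = π.L ∧ v outArray 2 = π.H) :
    Runs (setup e P) inp (setupWeight e * β * (π.N + τ + 1))
      fun s => Mem π inp 0 0 0 s ∧ Fresh π.M 0 s := by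
  obtain ⟨v, t, hv, ht, hm, hL, hH⟩ := hP
  have hβ := hf.pos
  have h6 : ∀ a, paramBank a ≠ 6 := fun a => by simp only [paramBank]; omega
  have hi := hf.inp_size 0 (by norm_num)
  have hn : nE.Reads IsParam := by simp [nE, IsParam]
  have hNE : NE.Reads IsParam := by simp [NE, IsParam]
  have hLE : LE.Reads IsParam := by simp [LE, IsParam]
  have hHE : HE.Reads IsParam := by simp [HE, IsParam]
  have hBE : BE.Reads IsParam := by simp [BE, IsParam]
  have s1 : (1 : ℕ).size ≤ β := by simpa using hβ
  have U₀ : (fun _ : ℕ => True) 0 := trivial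
  -- Once the parameter algorithm has run, only arrays outside its banks are known to be as in the
  -- input.
  set U : ℕ → Prop := fun a => ∀ b, a ≠ paramBank b with hU
  have hU0 : U 0 := fun b => by simp only [paramBank]; omega
  have p₀ : Pre (fun _ => True) inp (fun _ => 0) inp :=
    ⟨hinp 6 (by norm_num), fun _ _ _ => rfl⟩
  have z₀ : ∀ x, ((fun _ => 0 : ℕ → ℕ) x).size ≤ β := by simp
  have z₁ := size_update_le z₀ hf.N_size 2
  have z₂ := size_update_le z₁ s1 0
  have z₃ := size_update_le z₂ hf.m_size 3
  have z₄ := size_update_le z₃ hf.L_size 4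
  have z₅ := size_update_le z₄ hf.H_size 5
  have z₆ := size_update_le z₅ hf.B_size 6
  refine ((p₀.root U₀ hβ hi z₀ (R := π.N) (e := e) hN (by rw [hf.n_eq]; exact hNe)
    (by rw [hf.n_eq]; exact hNe') hf.N_size).seq fun s₁ p₁ =>
    (p₁.setReg U₀ hβ hi z₁ (x := 0) (y := 1) (by decide) trivial).seq fun s₂ p₂ =>
    (show Runs _ s₂ ((NE.weight + 20) * β) (fun s => Pre U inp
      (Function.update (Function.update (fun _ => 0) 2 π.N) 0 1) s ∧
      Holds paramBank 1 0 s (paramInput π.N)) from ?_).seq fun s₃ ⟨p₃, h₃⟩ =>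
    -- Stride `1` and part `0` give this run whole arrays, and the slowdown is `4 * 1 + 9 = 13`.
    (show Runs _ s₃ (13 * t) (fun s => Pre U inp
      (Function.update (Function.update (fun _ => 0) 2 π.N) 0 1) s ∧
      Holds paramBank 1 0 s v) from ?_).seq fun s₄ ⟨p₄, h₄⟩ =>
    (p₄.set_param h₄ hβ (x := 3) (y := 0) (e := 0) (by decide) (by norm_num) rfl (by decide)
      (by change 1 ≤ 5; norm_num) (by rw [show v 5 0 = π.m from hm]; exact hf.m_size)).seq
      fun s₅ ⟨p₅, h₅⟩ =>
    (p₅.set_param h₅ hβ (x := 4) (y := 1) (e := 1) (by decide) (by norm_num) rfl (by decide)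
      (by change 2 ≤ 5; norm_num) (by rw [show v 5 1 = π.L from hL]; exact hf.L_size)).seq
      fun s₆ ⟨p₆, h₆⟩ =>
    (p₆.set_param h₆ hβ (x := 5) (y := 2) (e := 2) (by decide) (by norm_num) rfl (by decide)
      (by change 3 ≤ 5; norm_num) (by rw [show v 5 2 = π.H from hH]; exact hf.H_size)).seq
      fun s₇ ⟨p₇, h₇⟩ =>
    (show Runs _ s₇ (((nE / (NE - 1) + 1).weight + 5) * β) (Pre U inp (Function.update
      (Function.update (Function.update (Function.update (Function.update (Function.update
        (fun _ => 0) 2 π.N) 0 1) 3 π.m) 4 π.L) 5 π.H) 6 π.B)) from ?_).seq fun s₈ p₈ =>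
    (p₈.setReg hU0 hβ hi z₆ (x := 0) (y := (nE / (LE * HE) + 1) * (BE * BE)) (by decide)
      ⟨⟨⟨hn, hLE, hHE⟩, trivial⟩, hBE, hBE⟩).mono le_rfl fun s₉ p₉ => ?_).mono_time ?_
  · have e₁ : (1 : Expr).eval s₁ = 1 := rfl
    rw [e₁] at p₂
    have eN : NE.eval s₂ = π.N := by simp [NE, p₂.reg]
    have hz : Holds paramBank 1 0 s₂ (fun _ _ => 0) := by
      refine ⟨by simp [p₂.reg], by simp [p₂.reg], fun a x => ?_⟩
      rw [p₂.eq _ (h6 a) trivial, hinp _ (by simp only [paramBank]; omega)]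
    obtain ⟨w₁, w₂⟩ := hz.write paramBank_injective h6 one_pos 0 0 π.N
    have e₂ : (0 : Expr).addr.eval s₂ = 0 * 1 + 0 := by
      rw [Expr.eval_addr, hz.stride, hz.part]; rfl
    refine (Runs.store ?_).mono_time ?_
    · rw [e₂, eN]
      refine ⟨⟨?_, fun a ha hUa => ?_⟩, ?_⟩
      · rw [← p₂.reg]
        ext x
        exact w₂ 6 x (Or.inl fun b => (h6 b).symm)
      · rw [← p₂.eq a ha trivial]
        ext x
        exact w₂ a x (Or.inl hUa)
      · convert w₁ using 1
        ext a x
        by_cases ha : a = 0 <;> by_cases hx : x = 0 <;>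
          simp [paramInput, State.write, natArray, ha, hx]
    · have c₁ := Expr.cost_addr_le hz one_pos (x := 0)
      have c₂ := p₂.cost_le trivial hβ hi z₂ hNE
      have c₃ : (0 : Expr).cost s₂ = 1 := rfl
      have c₄ : (0 : Expr).eval s₂ = 0 := rfl
      have : Nat.size 1 = 1 := by simp
      have : Nat.size 0 = 0 := by simp
      rw [c₄] at c₁
      rw [add_mul]
      omega
  · refine (hv.relocate paramBank_injective h6 one_pos s₃ h₃).mono ?_ fun s' h => ?_
    · simp
    · refine ⟨⟨?_, fun a ha hUa => ?_⟩, h.1⟩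
      · rw [← p₃.reg]
        ext x
        exact h.2 6 x (Or.inl fun b => (h6 b).symm)
      · rw [← p₃.eq a ha hUa]
        ext x
        exact h.2 a x (Or.inl hUa)
  · rw [show v 5 0 = π.m from hm, show v 5 1 = π.L from hL, show v 5 2 = π.H from hH] at p₇
    refine (p₇.setReg hU0 hβ hi z₅ (x := 6) (y := nE / (NE - 1) + 1) (by decide)
      ⟨⟨hn, hNE, trivial⟩, trivial⟩).mono le_rfl fun s' p => ?_
    have : (nE / (NE - 1) + 1).eval s₇ = π.B := by
      simp [nE, NE, p₇.reg, p₇.eq 0 (by norm_num) hU0, hf.n_eq, Params.B]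
    rwa [this] at p
  · have : ((nE / (LE * HE) + 1) * (BE * BE)).eval s₈ = π.M := by
      simp [nE, LE, HE, BE, p₈.reg, p₈.eq 0 (by norm_num) hU0, hf.n_eq, Params.M]
    rw [this] at p₉
    have hU' : ∀ a < 8, U a := fun a ha b => by simp only [paramBank]; omega
    refine ⟨⟨fun a ha => p₉.eq a (by omega) (hU' a (by omega)), ?_, ?_, ?_⟩, fun a x _ => ?_⟩
    · rw [p₉.reg]
      ext x
      rcases x with _ | _ | _ | _ | _ | _ | _ | x <;> simp [Params.registers]
    · rw [p₉.eq 7 (by norm_num) (hU' 7 (by norm_num)), hinp 7 (by norm_num)]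
      ext x; simp
    · rw [p₉.eq 5 (by norm_num) (hU' 5 (by norm_num)), hinp 5 (by norm_num)]
      ext x; simp
    -- Parameter banks have even numbers and transformer banks odd ones, so the latter are still
    -- blank.
    · rw [p₉.eq _ (bank_ne (by norm_num)) (fun b => by simp only [bank, paramBank]; omega),
        hinp _ (by simp only [bank]; omega)]
  · rw [setupWeight]
    have w₁ : (1 : Expr).weight = 2 := rfl
    rw [w₁]
    generalize (nE + 1 - (NE + 1).pow e).weight = w₁
    generalize (NE + 1).weight = w₂
    generalize NE.weight = w₃
    generalize (nE / (NE - 1) + 1).weight = w₄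
    generalize ((nE / (LE * HE) + 1) * (BE * BE)).weight = w₅
    generalize π.N = N
    have e : (w₁ + w₂ + w₃ + w₄ + w₅ + 300) * β * (N + τ + 1) =
      (w₁ + w₂ + 20) * β * (N + 1) + ((2 + 5) * β + ((w₃ + 20) * β + (13 * (β * τ) + (40 * β +
        (40 * β + (40 * β + ((w₄ + 5) * β + (w₅ + 5) * β))))))) +
      ((w₁ + w₂) * β * τ + (w₃ + w₄ + w₅) * β * (N + τ) + 280 * β * N + 287 * β * τ +
        123 * β) := by ring
    rw [e]
    have : t ≤ β * τ := ht.trans (Nat.le_mul_of_pos_left _ hβ)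
    omega

end Setup

/-- The algorithm for 3-OV that uses the algorithm `P` for transformers and the algorithm `Pparam` for
their parameters. -/
def reduction (e : ℕ) (Pparam P : Prog) : Prog := .seq (setup e Pparam) (processAll P)

/-- The reduction decides 3-OV. -/
theorem runs_reduction {π : Params} {A B C : Fin π.n → Fin π.d → Bool} {β τ₁ τ₂ e b : ℕ}
    {Pparam P : Prog} (hf : Fits π (ovInput A B C) β) (hn : 0 < π.n) (hN : 2 ≤ π.N)
    (hL : 1 ≤ π.L) (hH : 1 ≤ π.H) (hb : 1 ≤ b) (hm : 2 * π.d + 2 ≤ π.m)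
    (hNe : π.N ^ e ≤ π.n) (hNe' : π.n < (π.N + 1) ^ e)
    (hsmall : (π.L : ℝ) * π.H * (π.N * Real.exp (-π.N)) ≤ 1 / 10)
    (hparam : Runs Pparam (paramInput π.N) τ₁ fun v =>
      v outArray 0 = π.m ∧ v outArray 1 = π.L ∧ v outArray 2 = π.H)
    (hP : ∀ (W : Weights π.m π.L π.H) (X : Matrix (Fin π.N) (Fin π.m) ℚ),
      W.Bounded (π.N ^ b) → (∀ i j, RatBounded (π.N ^ b) (X i j)) →
        Runs P (transformerInput W X) τ₂ (OutputsApprox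
          (W.transformer.eval (X.map (fun r : ℚ => (r : ℝ)))) (1 / (10 * (π.N : ℝ))))) :
    Runs (reduction e Pparam P) (ovInput A B C)
      ((setupWeight e + processWeight + 11) * β * ((π.N + τ₁ + 1) +
        (π.N * π.m + π.L * (π.H * (π.m * π.m)) + τ₂ + 1) * (π.M + 1)))
      fun s => (s outArray 0 ≠ 0 ↔ ∃ i j k, OrthogonalTriple (A i) (B j) (C k)) := by
  have hbit : ∀ a x, a = 1 ∨ a = 2 → ovInput A B C a x ≤ 1 := by
    rintro a x (rfl | rfl)
    all_goals
      simp only [ovInput, natArray, rowMajor]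
      split_ifs
      · exact Bool.toNat_le _
      · omega
  refine ((runs_setup hf ?_ (by omega) hNe hNe' hparam).seq fun s h =>
    (h.1.processAll h.2 hf (by omega) (by omega)
      (succeeds_of_computes hbit hN hb hm hsmall hP)).mono le_rfl fun s' hs' => ?_).mono_time ?_
  · intro a ha
    obtain ⟨a, rfl⟩ : ∃ a', a = a' + 4 := ⟨a - 4, by omega⟩
    rfl
  · rw [hs', exists_found_iff hn hL hH hN, exists_orthogonalTriple_iff]
  · generalize π.N + τ₁ + 1 = x
    generalize π.N * π.m + π.L * (π.H * (π.m * π.m)) + τ₂ + 1 = y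
    generalize setupWeight e = w₁
    generalize processWeight = w₂
    generalize π.M + 1 = M
    have e : (w₁ + w₂ + 11) * β * (x + y * M) = w₁ * β * x + (w₂ + 11) * β * y * M +
      (w₁ * β * (y * M) + (w₂ + 11) * β * x) := by ring
    rw [e]
    exact Nat.le_add_right _ _

/-! ### The running time -/

/-- The longest products are `M`, with three factors of at most `n.size + 1` bits each, and the
number of weights, with four factors of at most `n.size` bits. -/
theorem fits_of_le {π : Params} {A B C : Fin π.n → Fin π.d → Bool} (hn : 0 < π.n)
    (hN : π.N ≤ π.n) (hd : π.d ≤ π.n) (hm : π.m ≤ π.n) (hL : π.L ≤ π.n) (hH : π.H ≤ π.n) :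
    Fits π (ovInput A B C) (8 * π.n.size) := by
  have hs : 0 < π.n.size := Nat.size_pos.2 hn
  have h₁ : ∀ {x}, x ≤ π.n → x.size ≤ π.n.size := fun h => Nat.size_le_size h
  have h₂ : ∀ x, (π.n / x + 1).size ≤ π.n.size + 1 := by
    intro x
    have := size_add_le (π.n / x) 1
    have := h₁ (Nat.div_le_self π.n x)
    have : Nat.size 1 = 1 := by simp
    omega
  have hB : π.B.size ≤ π.n.size + 1 := h₂ _
  have hmm := size_mul_le π.m π.m
  have hHmm := size_mul_le π.H (π.m * π.m)
  have hLHmm := size_mul_le π.L (π.H * (π.m * π.m))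
  have hBB := size_mul_le π.B π.B
  have hM := size_mul_le (π.n / (π.L * π.H) + 1) (π.B * π.B)
  have hNm := size_mul_le π.N π.m
  have := h₂ (π.L * π.H)
  have := h₁ hN
  have := h₁ hm
  have := h₁ hL
  have := h₁ hH
  refine ⟨rfl, rfl, by omega, ?_, ?_, by omega, by omega, by omega, by omega, by omega, by omega,
    by omega⟩
  · intro a ha x
    have bit : ∀ (F : Fin π.n → Fin π.d → Bool) (x : ℕ),
        (natArray (rowMajor fun i j => (F i j).toNat) x).size ≤ 8 * π.n.size := by
      intro F x
      refine (h₁ ?_).trans (by omega)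
      simp only [natArray, rowMajor]
      split_ifs
      · exact (Bool.toNat_le _).trans hn
      · omega
    interval_cases a
    · refine (h₁ (x := natArray ![π.n, π.d] x) ?_).trans (by omega)
      rw [natArray]
      split_ifs with hx
      · interval_cases x
        · exact le_rfl
        · exact hd
      · omega
    · exact bit A x
    · exact bit B x
    · exact bit C x
  · rw [Params.M]
    omega

/-- Rounding up at most doubles the number of chunks times `L * H` beyond `n`, and likewise for
blocks of `N - 1`; passing from `N - 1` to `N` costs another `2`. This gives `2 * 4 * 4 = 32`,
doubled to absorb the `+ 1`. -/
theorem M_mul_le {π : Params} (hN : 2 ≤ π.N)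
    (hLH : π.L * π.H ≤ π.n) (hNn : π.N ≤ π.n) :
    ((π.M : ℝ) + 1) * (π.L * π.H * (π.N : ℝ) ^ 2) ≤ 64 * (π.n : ℝ) ^ 3 := by
  have h₁ : (π.n / (π.L * π.H) + 1) * (π.L * π.H) ≤ 2 * π.n := by
    have := Nat.div_mul_le_self π.n (π.L * π.H)
    rw [add_mul]
    omega
  have h₂ : π.B * π.N ≤ 4 * π.n := by
    have h := Nat.div_mul_le_self π.n (π.N - 1)
    have : π.B * (π.N - 1) ≤ 2 * π.n := by
      rw [Params.B, add_mul]
      omega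
    have : π.B * π.N ≤ π.B * (2 * (π.N - 1)) := Nat.mul_le_mul_left _ (by omega)
    nlinarith
  have hM : 1 ≤ π.M := Nat.mul_pos (Nat.succ_pos _) (Nat.mul_pos (Nat.succ_pos _) (Nat.succ_pos _))
  have h₃ : π.M * (π.L * π.H * π.N ^ 2) ≤ 32 * π.n ^ 3 := by
    calc π.M * (π.L * π.H * π.N ^ 2)
        = ((π.n / (π.L * π.H) + 1) * (π.L * π.H)) * ((π.B * π.N) * (π.B * π.N)) := by
          rw [Params.M]; ring
      _ ≤ (2 * π.n) * ((4 * π.n) * (4 * π.n)) := by gcongr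
      _ = 32 * π.n ^ 3 := by ring
  have h₄ : (π.M + 1) * (π.L * π.H * π.N ^ 2) ≤ 64 * π.n ^ 3 := by
    calc (π.M + 1) * (π.L * π.H * π.N ^ 2) ≤ (2 * π.M) * (π.L * π.H * π.N ^ 2) := by gcongr; omega
      _ ≤ 64 * π.n ^ 3 := by linarith
  exact_mod_cast h₄

/-- Writing inputs and scanning outputs are dominated by `m ^ 2 * L * H * N ^ (2 - δ)` per
transformer; `δ ≤ 1` ensures `N ≤ N ^ (2 - δ)`. Setup takes only `O(n)`. -/
theorem total_time_le {π : Params} {τ₁ τ₂ k : ℕ} {K₁ K₂ ε δ : ℝ} (hN : 2 ≤ π.N) (hL : 1 ≤ π.L)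
    (hH : 1 ≤ π.H) (hm : 1 ≤ π.m) (hLH : π.L * π.H ≤ π.n) (hNn : π.N ^ (k + 1) ≤ π.n)
    (hδ : δ ≤ 1) (hδε : δ ≤ ε) (hK₁ : 0 ≤ K₁) (hK₂ : 0 ≤ K₂)
    (hτ₁ : (τ₁ : ℝ) ≤ K₁ * (π.N : ℝ) ^ k)
    (hτ₂ : (τ₂ : ℝ) ≤ K₂ * ((π.L : ℝ) * π.H * (π.N : ℝ) ^ (2 - ε))) :
    ((((π.N + τ₁ + 1) + (π.N * π.m + π.L * (π.H * (π.m * π.m)) + τ₂ + 1) * (π.M + 1) : ℕ)) : ℝ) ≤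
      (2 + K₁ + 64 * (3 + K₂)) * ((π.m : ℝ) ^ 2 * ((π.n : ℝ) ^ 3 * (π.N : ℝ) ^ (-δ))) := by
  have hNn' : π.N ≤ π.n := (Nat.le_self_pow (by omega) _).trans hNn
  have hM := M_mul_le hN hLH hNn'
  have rN : (2 : ℝ) ≤ π.N := by exact_mod_cast hN
  have rL : (1 : ℝ) ≤ π.L := by exact_mod_cast hL
  have rH : (1 : ℝ) ≤ π.H := by exact_mod_cast hH
  have rm : (1 : ℝ) ≤ π.m := by exact_mod_cast hm
  have rn : (π.N : ℝ) ≤ π.n := by exact_mod_cast hNn'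
  have rNk : (π.N : ℝ) ^ (k + 1) ≤ π.n := by exact_mod_cast hNn
  have rLH : (1 : ℝ) ≤ π.L * π.H := one_le_mul_of_one_le_of_one_le rL rH
  have rm2 : (1 : ℝ) ≤ (π.m : ℝ) ^ 2 := one_le_pow₀ rm
  have N0 : (0 : ℝ) < π.N := by linarith
  have n0 : (0 : ℝ) < π.n := by linarith
  have hp : (π.N : ℝ) ^ (2 - δ) = (π.N : ℝ) ^ 2 * (π.N : ℝ) ^ (-δ) := by
    rw [sub_eq_add_neg, Real.rpow_add N0]
    norm_cast
  have hp₁ : (π.N : ℝ) ≤ (π.N : ℝ) ^ (2 - δ) := by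
    conv_lhs => rw [← Real.rpow_one (π.N : ℝ)]
    exact Real.rpow_le_rpow_of_exponent_le (by linarith) (by linarith)
  have hp₂ : (π.N : ℝ) ^ (2 - ε) ≤ (π.N : ℝ) ^ (2 - δ) :=
    Real.rpow_le_rpow_of_exponent_le (by linarith) (by linarith)
  have hδ0 : 0 < (π.N : ℝ) ^ (-δ) := Real.rpow_pos_of_pos N0 _
  have hδ1 : 1 ≤ (π.n : ℝ) * (π.N : ℝ) ^ (-δ) := by
    have : (1 : ℝ) ≤ π.N * (π.N : ℝ) ^ (-δ) := by
      have h : (π.N : ℝ) * (π.N : ℝ) ^ (-δ) = (π.N : ℝ) ^ (1 - δ) := by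
        rw [sub_eq_add_neg, Real.rpow_add N0, Real.rpow_one]
      rw [h]
      exact Real.one_le_rpow (by linarith) (by linarith)
    refine this.trans ?_
    gcongr
  have h₁ : (π.N : ℝ) + τ₁ + 1 ≤
      (2 + K₁) * ((π.m : ℝ) ^ 2 * ((π.n : ℝ) ^ 3 * (π.N : ℝ) ^ (-δ))) := by
    have a₁ : (π.N : ℝ) ^ k ≤ π.n :=
      (pow_le_pow_right₀ (by linarith) (Nat.le_succ k)).trans rNk
    have a₂ : (π.N : ℝ) + τ₁ + 1 ≤ (2 + K₁) * π.n := by nlinarith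
    refine a₂.trans (mul_le_mul_of_nonneg_left ?_ (by positivity))
    have a₃ : (π.n : ℝ) ^ 3 * (π.N : ℝ) ^ (-δ) = π.n ^ 2 * (π.n * (π.N : ℝ) ^ (-δ)) := by ring
    have a₄ : (π.n : ℝ) ≤ (π.n : ℝ) ^ 2 := by nlinarith
    calc (π.n : ℝ) ≤ 1 * (π.n ^ 2 * 1) := by linarith
      _ ≤ _ := by rw [a₃]; gcongr
  have h₂ : (π.N : ℝ) * π.m + π.L * (π.H * (π.m * π.m)) + τ₂ + 1 ≤
      (3 + K₂) * ((π.m : ℝ) ^ 2 * (π.L * π.H * (π.N : ℝ) ^ (2 - δ))) := by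
    set p := (π.N : ℝ) ^ (2 - δ) with hp
    set q := (π.L : ℝ) * π.H with hq
    have p0 : 0 < p := by linarith
    have b₀ : q * p ≤ (π.m : ℝ) ^ 2 * (q * p) :=
      le_mul_of_one_le_left (by positivity) rm2
    have b₀' : p ≤ q * p := le_mul_of_one_le_left p0.le rLH
    have b₁ : (π.N : ℝ) * π.m ≤ (π.m : ℝ) ^ 2 * (q * p) := by
      calc (π.N : ℝ) * π.m = π.m * π.N := mul_comm _ _
        _ ≤ (π.m : ℝ) ^ 2 * (q * p) := by
          gcongr
          · nlinarith
          · linarith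
    have b₂ : (π.L : ℝ) * (π.H * (π.m * π.m)) ≤ (π.m : ℝ) ^ 2 * (q * p) := by
      calc (π.L : ℝ) * (π.H * (π.m * π.m)) = (π.m : ℝ) ^ 2 * (q * 1) := by rw [hq]; ring
        _ ≤ _ := by gcongr; linarith
    have b₃ : (τ₂ : ℝ) ≤ K₂ * ((π.m : ℝ) ^ 2 * (q * p)) := by
      refine hτ₂.trans (mul_le_mul_of_nonneg_left ?_ hK₂)
      refine le_trans ?_ b₀
      gcongr
    have b₄ : (1 : ℝ) ≤ (π.m : ℝ) ^ 2 * (q * p) := by linarith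
    linarith
  push_cast
  rw [add_mul (2 + K₁)]
  refine add_le_add h₁ ?_
  calc ((π.N : ℝ) * π.m + π.L * (π.H * (π.m * π.m)) + τ₂ + 1) * (π.M + 1)
      ≤ ((3 + K₂) * ((π.m : ℝ) ^ 2 * (π.L * π.H * (π.N : ℝ) ^ (2 - δ)))) * (π.M + 1) := by
        gcongr
    _ = (3 + K₂) * ((π.m : ℝ) ^ 2 * ((((π.M : ℝ) + 1) * (π.L * π.H * (π.N : ℝ) ^ 2)) *
          (π.N : ℝ) ^ (-δ))) := by rw [hp]; ring
    _ ≤ (3 + K₂) * ((π.m : ℝ) ^ 2 * ((64 * (π.n : ℝ) ^ 3) * (π.N : ℝ) ^ (-δ))) := by gcongr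
    _ = _ := by ring

/-! ### Roots, logarithms and asymptotic comparisons -/

/-- The largest `r` with `r ^ e ≤ n`. -/
def floorRoot (e n : ℕ) : ℕ := Nat.findGreatest (fun r => r ^ e ≤ n) n

theorem floorRoot_pow_le {e : ℕ} (he : e ≠ 0) (n : ℕ) : floorRoot e n ^ e ≤ n :=
  Nat.findGreatest_spec (P := fun r => r ^ e ≤ n) (Nat.zero_le n) (by simp [he])

theorem lt_floorRoot_succ_pow {e : ℕ} (he : e ≠ 0) (n : ℕ) : n < (floorRoot e n + 1) ^ e := by
  by_cases h : floorRoot e n + 1 ≤ n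
  · have := Nat.findGreatest_is_greatest (P := fun r => r ^ e ≤ n) (Nat.lt_succ_self _) h
    exact not_le.1 this
  · have := Nat.le_self_pow he (floorRoot e n + 1)
    omega

theorem tendsto_floorRoot {e : ℕ} (he : e ≠ 0) : Tendsto (floorRoot e) atTop atTop := by
  refine tendsto_atTop.2 fun r => eventually_atTop.2 ⟨r ^ e, fun n hn => ?_⟩
  exact Nat.le_findGreatest ((Nat.le_self_pow he r).trans hn) hn

theorem clog_le_of_lt_pow {n N e : ℕ} (h : n < (N + 1) ^ e) : Nat.clog 2 n ≤ e * N.size := by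
  refine (Nat.clog_le_iff_le_pow (by norm_num)).2 (h.le.trans ?_)
  rw [mul_comm, pow_mul]
  exact Nat.pow_le_pow_left (Nat.lt_size_self N) e

theorem size_le_logb {N : ℕ} (hN : 1 ≤ N) : (N.size : ℝ) ≤ Real.logb 2 N + 1 := by
  have h : 2 ^ (N.size - 1) ≤ N := Nat.lt_size.1 (by have := Nat.size_pos.2 hN; omega)
  have h₁ : ((N.size - 1 : ℕ) : ℝ) ≤ Real.logb 2 N := by
    rw [Real.le_logb_iff_rpow_le (by norm_num) (by exact_mod_cast hN)]
    exact_mod_cast h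
  have h₂ : (N.size : ℝ) ≤ ((N.size - 1 : ℕ) : ℝ) + 1 := by
    exact_mod_cast (by omega : N.size ≤ N.size - 1 + 1)
  linarith

theorem runs_of_runsWithin {P : Prog} {s : State} {T : ℝ} {post : State → Prop}
    (h : RunsWithin P s T post) : Runs P s ⌊T⌋₊ post := by
  obtain ⟨s', t, h₁, h₂, h₃⟩ := h
  exact ⟨s', t, h₁, Nat.le_floor h₂, h₃⟩

theorem floor_mul_le (K : ℝ) {x : ℝ} (hx : 0 ≤ x) : (⌊K * x⌋₊ : ℝ) ≤ |K| * x := by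
  refine le_trans ?_ (Nat.floor_le (by positivity))
  exact_mod_cast Nat.floor_mono (mul_le_mul_of_nonneg_right (le_abs_self K) hx)

/-- Converts a saving in `N` into one in `n`: since `n ≤ (2 * N) ^ e`, only a factor `2 ^ δ ≤ 2` is
lost. -/
theorem rpow_neg_le_of_lt_pow {n N e : ℕ} {δ : ℝ} (he : e ≠ 0) (hn : 0 < n) (hN : 1 ≤ N)
    (h : n < (N + 1) ^ e) (hδ : 0 ≤ δ) (hδ' : δ ≤ 1) :
    (N : ℝ) ^ (-δ) ≤ 2 * (n : ℝ) ^ (-(δ / e)) := by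
  have N0 : (0 : ℝ) < N := by exact_mod_cast hN
  have n0 : (0 : ℝ) < n := by exact_mod_cast hn
  have e0 : (0 : ℝ) < e := by exact_mod_cast Nat.pos_of_ne_zero he
  have h₁ : (n : ℝ) ≤ (2 * N) ^ e := by
    have : n ≤ (2 * N) ^ e := h.le.trans (Nat.pow_le_pow_left (by omega) e)
    exact_mod_cast this
  have h₂ : (n : ℝ) ^ (δ / e) ≤ 2 * (N : ℝ) ^ δ := by
    calc (n : ℝ) ^ (δ / e) ≤ ((2 * (N : ℝ)) ^ e) ^ (δ / e) :=
          Real.rpow_le_rpow n0.le h₁ (by positivity)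
      _ = (2 * (N : ℝ)) ^ δ := by
          rw [← Real.rpow_natCast, ← Real.rpow_mul (by positivity)]
          congr 1
          field_simp
      _ = (2 : ℝ) ^ δ * (N : ℝ) ^ δ := Real.mul_rpow (by norm_num) N0.le
      _ ≤ (2 : ℝ) ^ (1 : ℝ) * (N : ℝ) ^ δ := by
          gcongr
          norm_num
      _ = 2 * (N : ℝ) ^ δ := by rw [Real.rpow_one]
  have p₁ : 0 < (N : ℝ) ^ δ := Real.rpow_pos_of_pos N0 _
  have p₂ : 0 < (n : ℝ) ^ (δ / e) := Real.rpow_pos_of_pos n0 _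
  rw [Real.rpow_neg N0.le, Real.rpow_neg n0.le, ← div_eq_mul_inv, inv_eq_one_div,
    div_le_div_iff₀ p₁ p₂]
  linarith

/-- The parameters that are used for 3-OV on `n` vectors of dimension `d`. -/
def paramsFor (e : ℕ) (m L H : ℕ → ℕ) (n d : ℕ) : Params :=
  ⟨n, d, floorRoot e n, m (floorRoot e n), L (floorRoot e n), H (floorRoot e n)⟩

/-- The extra `1` in the exponent swallows the implied constants. -/
theorem eventually_mul_le {L H : ℕ → ℕ} {k : ℕ}
    (hL : (fun N => (L N : ℝ)) =O[atTop] (fun N : ℕ => (N : ℝ) ^ k))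
    (hH : (fun N => (H N : ℝ)) =O[atTop] (fun N : ℕ => (N : ℝ) ^ k)) :
    ∀ᶠ N : ℕ in atTop, L N * H N ≤ N ^ (2 * k + 1) := by
  obtain ⟨C, hC⟩ := (hL.mul hH).bound
  filter_upwards [hC, eventually_ge_atTop ⌈C⌉₊] with N h₁ h₂
  have h₃ : C ≤ N := Nat.ceil_le.1 h₂
  rw [Real.norm_of_nonneg (by positivity), Real.norm_of_nonneg (by positivity)] at h₁
  have : (L N : ℝ) * H N ≤ (N : ℝ) ^ (2 * k + 1) := by
    refine h₁.trans ?_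
    rw [pow_succ', two_mul, pow_add]
    gcongr
  exact_mod_cast this

theorem eventually_mul_exp_le (k : ℕ) :
    ∀ᶠ N : ℕ in atTop, (N : ℝ) ^ k * Real.exp (-N) ≤ 1 / 10 :=
  ((Real.tendsto_pow_mul_exp_neg_atTop_nhds_zero k).comp
    tendsto_natCast_atTop_atTop).eventually_le_const (by norm_num)

theorem eventually_le_self {m : ℕ → ℕ}
    (hm : (fun N => (m N : ℝ)) =O[atTop] (fun N : ℕ => Real.log N)) :
    ∀ᶠ N : ℕ in atTop, m N ≤ N := by
  have h := hm.trans_isLittleO (Real.isLittleO_log_id_atTop.comp_tendsto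
    (tendsto_natCast_atTop_atTop (R := ℝ)))
  filter_upwards [h.bound one_pos] with N h₁
  simpa using h₁

theorem eventually_log_pow_le {s : ℝ} (hs : 0 < s) :
    ∀ᶠ n : ℕ in atTop, (Real.log n) ^ 3 ≤ (n : ℝ) ^ s := by
  have h := (isLittleO_log_rpow_rpow_atTop 3 hs).comp_tendsto
    (tendsto_natCast_atTop_atTop (R := ℝ))
  filter_upwards [h.bound one_pos] with n h₁
  have h₂ : (Real.log n) ^ (3 : ℝ) = (Real.log n) ^ 3 := by norm_cast
  simp only [Function.comp_apply, h₂, one_mul] at h₁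
  rw [Real.norm_of_nonneg (Real.rpow_nonneg (by positivity) _)] at h₁
  exact (le_abs_self _).trans h₁

theorem eventually_size_le : ∀ᶠ n : ℕ in atTop, (n.size : ℝ) ≤ 3 * Real.log n := by
  filter_upwards [eventually_ge_atTop 3] with n hn
  have h₁ := size_le_logb (N := n) (by omega)
  have h₂ : 1 ≤ Real.log n := by
    rw [Real.le_log_iff_exp_le (by positivity)]
    have := Real.exp_one_lt_d9
    have : (3 : ℝ) ≤ n := by exact_mod_cast hn
    linarith
  have h₃ : Real.logb 2 n ≤ 2 * Real.log n := by
    rw [Real.logb, div_le_iff₀ (Real.log_pos (by norm_num))]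
    have := Real.log_two_gt_d9
    nlinarith
  linarith

/-- An algorithm that computes transformers fast gives one that decides 3-OV fast. -/
theorem solvesThreeOV {ε δ : ℝ} {k c c' e b : ℕ} {m L H : ℕ → ℕ} {P Pparam : Prog} {K₁ : ℝ}
    (hδ : 0 < δ) (hδ1 : δ ≤ 1) (hδε : δ ≤ ε) (he : e = 2 * k + 2) (hc : c = 4 * c' * e + 2)
    (hm : (fun N => (m N : ℝ)) =O[atTop] (fun N : ℕ => Real.log N))
    (hcm : ∀ᶠ N : ℕ in atTop, (c : ℝ) * Real.logb 2 N ≤ m N)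
    (hpos : ∀ᶠ N : ℕ in atTop, 1 ≤ L N ∧ 1 ≤ H N)
    (hL : (fun N => (L N : ℝ)) =O[atTop] (fun N : ℕ => (N : ℝ) ^ k))
    (hH : (fun N => (H N : ℝ)) =O[atTop] (fun N : ℕ => (N : ℝ) ^ k))
    (hparam : ∀ᶠ N : ℕ in atTop, RunsWithin Pparam (paramInput N) (K₁ * (N : ℝ) ^ k)
      fun s => s outArray 0 = m N ∧ s outArray 1 = L N ∧ s outArray 2 = H N)
    (hb : 1 ≤ b)
    (hP : ComputesTransformers P m L H b
      (fun N => (L N : ℝ) * (H N : ℝ) * (N : ℝ) ^ (2 - ε))) :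
    SolvesThreeOV (reduction e Pparam P) (fun n => c' * Nat.clog 2 n)
      (fun n => (n : ℝ) ^ (3 - δ / (2 * e))) := by
  obtain ⟨K₂, hP⟩ := hP
  obtain ⟨Cm, hCm0, hCm⟩ := hm.exists_nonneg
  have hCm := hCm.bound
  have he0 : e ≠ 0 := by omega
  have e0 : (0 : ℝ) < e := by exact_mod_cast Nat.pos_of_ne_zero he0
  have hroot := tendsto_floorRoot he0
  set W : ℕ := setupWeight e + processWeight + 11 with hW
  set K₃ : ℝ := 2 + |K₁| + 64 * (3 + |K₂|) with hK₃
  -- Here `24 = 8 * 3` comes from `β = 8 * n.size` and `n.size ≤ 3 * log n`, `Cm ^ 2` from `m ^ 2`,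
  -- and the last `2` from replacing `N` by the root of `n`.
  refine ⟨W * 24 * (K₃ * (Cm ^ 2 * 2)), ?_⟩
  filter_upwards [eventually_ge_atTop 1, hroot.eventually (eventually_ge_atTop 2),
    hroot.eventually hCm, hroot.eventually hcm, hroot.eventually hpos,
    hroot.eventually (eventually_mul_le hL hH), hroot.eventually (eventually_mul_exp_le e),
    hroot.eventually (eventually_le_self hm), hroot.eventually hparam, hroot.eventually hP,
    eventually_log_pow_le (s := δ / (2 * e)) (by positivity), eventually_size_le]
    with n hn hN hCm hcm hpos hLH hexp hmN hparam hP hlog hsize A B C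
  obtain ⟨hL, hH⟩ := hpos
  have hNe := floorRoot_pow_le he0 n
  have hNe' := lt_floorRoot_succ_pow he0 n
  set N := floorRoot e n with hNdef
  set π : Params := paramsFor e m L H n (c' * Nat.clog 2 n) with hπ
  have hNn : N ≤ n := (Nat.le_self_pow he0 N).trans hNe
  have rN : (2 : ℝ) ≤ N := by exact_mod_cast hN
  have hLH' : L N * H N ≤ n :=
    (hLH.trans (Nat.pow_le_pow_right (by omega) (by omega))).trans hNe
  have hd : 2 * (c' * Nat.clog 2 n) + 2 ≤ m N := by
    have h₁ : (Nat.clog 2 n : ℝ) ≤ e * N.size := by exact_mod_cast clog_le_of_lt_pow hNe'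
    have h₂ := size_le_logb (N := N) (by omega)
    have h₃ : 1 ≤ Real.logb 2 N := by
      rw [Real.le_logb_iff_rpow_le (by norm_num) (by linarith), Real.rpow_one]
      exact rN
    have h₄ : (2 * (c' * Nat.clog 2 n) + 2 : ℝ) ≤ m N := by
      -- The value of `c` comes from here: `log n` is at most `e * (log N + 1)`, and both `1`s are
      -- bounded by `logb 2 N` because `N ≥ 2`.
      calc (2 * (c' * Nat.clog 2 n) + 2 : ℝ)
          ≤ 2 * (c' * (e * (Real.logb 2 N + Real.logb 2 N))) + 2 * Real.logb 2 N := by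
            gcongr
            · exact h₁.trans (by gcongr; linarith)
            · linarith
        _ = c * Real.logb 2 N := by rw [hc]; push_cast; ring
        _ ≤ m N := hcm
    exact_mod_cast h₄
  have hsmall : (L N : ℝ) * H N * (N * Real.exp (-N)) ≤ 1 / 10 := by
    refine le_trans ?_ hexp
    have : (L N : ℝ) * H N ≤ (N : ℝ) ^ (2 * k + 1) := by exact_mod_cast hLH
    calc (L N : ℝ) * H N * (N * Real.exp (-N))
        ≤ (N : ℝ) ^ (2 * k + 1) * (N * Real.exp (-N)) := by gcongr
      _ = (N : ℝ) ^ e * Real.exp (-N) := by rw [he]; ring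
  have hfits : Fits π (ovInput A B C) (8 * n.size) :=
    fits_of_le (π := π) hn hNn ((show c' * Nat.clog 2 n ≤ m N by omega).trans (hmN.trans hNn))
      (hmN.trans hNn)
      ((Nat.le_mul_of_pos_right _ hH).trans hLH') ((Nat.le_mul_of_pos_left _ hL).trans hLH')
  have main := runs_reduction (π := π) (A := A) (B := B) (C := C) hfits hn hN hL hH hb hd hNe hNe'
    hsmall (runs_of_runsWithin hparam) (fun W X hW hX => runs_of_runsWithin (hP W X hW hX))
  obtain ⟨s', t, h₁, h₂, h₃⟩ := main
  refine ⟨s', t, h₁, ?_, h₃⟩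
  have hτ := total_time_le (π := π) (k := k) (ε := ε) (δ := δ) (K₁ := |K₁|) (K₂ := |K₂|) hN hL hH
    (by change 1 ≤ m N; omega) hLH'
    ((Nat.pow_le_pow_right (show 0 < N by omega) (by omega)).trans hNe)
    hδ1 hδε (abs_nonneg _) (abs_nonneg _)
    (floor_mul_le K₁ (by positivity : (0 : ℝ) ≤ (N : ℝ) ^ k))
    (floor_mul_le K₂ (by positivity : (0 : ℝ) ≤ (L N : ℝ) * (H N : ℝ) * (N : ℝ) ^ (2 - ε)))
  have hδN := rpow_neg_le_of_lt_pow (δ := δ) he0 hn (by omega) hNe' hδ.le hδ1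
  have n0 : (0 : ℝ) < n := by exact_mod_cast hn
  have N0 : (0 : ℝ) < N := by linarith
  have hlogN : (m N : ℝ) ^ 2 ≤ (Cm * Real.log n) ^ 2 := by
    rw [Real.norm_of_nonneg (by positivity), Real.norm_of_nonneg (Real.log_natCast_nonneg N)]
      at hCm
    refine pow_le_pow_left₀ (by positivity) (hCm.trans ?_) 2
    gcongr
  have hlog0 : 0 ≤ Real.log n := Real.log_natCast_nonneg n
  rw [← hK₃] at hτ
  have hK₃0 : 0 ≤ K₃ := by positivity
  have ht : (t : ℝ) ≤ (W * (8 * n.size) : ℕ) *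
      (K₃ * ((m N : ℝ) ^ 2 * ((n : ℝ) ^ 3 * (N : ℝ) ^ (-δ)))) := by
    have h := (Nat.cast_le (α := ℝ)).2 h₂
    rw [Nat.cast_mul] at h
    exact h.trans (mul_le_mul_of_nonneg_left hτ (Nat.cast_nonneg _))
  push_cast at ht
  calc (t : ℝ) ≤ (W : ℝ) * (8 * n.size) *
          (K₃ * ((m N : ℝ) ^ 2 * ((n : ℝ) ^ 3 * (N : ℝ) ^ (-δ)))) := ht
    _ ≤ (W : ℝ) * (8 * (3 * Real.log n)) * (K₃ * ((Cm * Real.log n) ^ 2 * ((n : ℝ) ^ 3 *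
          (2 * (n : ℝ) ^ (-(δ / e)))))) := by
        refine mul_le_mul (by gcongr) ?_ (by positivity) (by positivity)
        refine mul_le_mul_of_nonneg_left ?_ hK₃0
        exact mul_le_mul hlogN (mul_le_mul_of_nonneg_left hδN (by positivity)) (by positivity)
          (by positivity)
    _ = W * 24 * (K₃ * (Cm ^ 2 * 2)) * ((Real.log n) ^ 3 * ((n : ℝ) ^ 3 *
          (n : ℝ) ^ (-(δ / e)))) := by ring
    -- Half of the saving `n ^ (δ / e)` is spent on three logarithms, one from the bit length and
    -- two from `m ^ 2`.
    _ ≤ W * 24 * (K₃ * (Cm ^ 2 * 2)) * ((n : ℝ) ^ (δ / (2 * e)) * ((n : ℝ) ^ 3 *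
          (n : ℝ) ^ (-(δ / e)))) := by gcongr
    _ = _ := by
        congr 1
        rw [← Real.rpow_natCast (n : ℝ) 3, ← Real.rpow_add n0, ← Real.rpow_add n0]
        congr 1
        push_cast
        field_simp
        ring

end Reduction

theorem mainTheorem2 (hOV : ThreeOVHypothesis) (ε : ℝ) (hε : 0 < ε) (k : ℕ) :
    ∃ c : ℕ, ∀ m L H : ℕ → ℕ,
      (fun N => (m N : ℝ)) =Θ[atTop] (fun N : ℕ => Real.log N) →
      (∀ᶠ N : ℕ in atTop, (c : ℝ) * Real.logb 2 N ≤ m N) →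
      (∀ᶠ N : ℕ in atTop, 1 ≤ L N ∧ 1 ≤ H N) →
      (fun N => (L N : ℝ)) =O[atTop] (fun N : ℕ => (N : ℝ) ^ k) →
      (fun N => (H N : ℝ)) =O[atTop] (fun N : ℕ => (N : ℝ) ^ k) →
      ComputableParams m L H (fun N => (N : ℝ) ^ k) →
      ∀ b : ℕ, 1 ≤ b →
        ¬ ∃ P : Prog, ComputesTransformers P m L H b
          (fun N => (L N : ℝ) * (H N : ℝ) * (N : ℝ) ^ (2 - ε)) := by
  have hδ : 0 < min ε 1 := lt_min hε one_pos
  -- The hypothesis is invoked with exactly the saving that is left; it depends only on `ε` and `k`,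
  -- so `c` is fixed before `m`, `L`, `H` and `b`.
  obtain ⟨c', hc'⟩ := hOV (min ε 1 / (2 * ((2 * k + 2 : ℕ) : ℝ))) (by positivity)
  refine ⟨4 * c' * (2 * k + 2) + 2, fun m L H hm hcm hpos hL hH hparam b hb ⟨P, hP⟩ => hc' ?_⟩
  obtain ⟨Pparam, K₁, hparam⟩ := hparam
  exact ⟨_, Reduction.solvesThreeOV hδ (min_le_right _ _) (min_le_left _ _) rfl rfl hm.1 hcm hpos
    hL hH hparam hb hP⟩
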